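/- Let $\pi\colon S^7\to\mathbb{C}P^3$ be the Hopf fibration, where $S^7$ is the unit sphere of $\mathbb{C}^4=\mathbb{H}^2$ via $(z_0,z_1,z_2,z_3)\mapsto(z_0+z_1j,\,z_2+z_3j)$, and let $g_1$ be the Fubini--Study metric on $\mathbb{C}P^3$ for which $\pi$ is a Riemannian submersion from the round unit sphere. Let $\mathcal{D}_1$ be the rank-two distribution on $\mathbb{C}P^3$ that is the image under $d\pi$ of $\operatorname{span}_{\mathbb{R}}\{jp,kp\}\subset T_pS^7$, let $\mathcal{D}_2$ be its $g_1$-orthogonal complement, and let $P$ be the tensor that is $-1$ on $\mathcal{D}_1$ and $+1$ on $\mathcal{D}_2$. For $a>0$ let $$ g_a(X,Y)=\frac{1+a}{2}\,g_1(X,Y)+\frac{a-1}{2}\,g_1(PX,Y) $$ (these are, up to rescaling, the homogeneous Riemannian metrics on $\mathbb{C}P^3$). A hypersurface of $(\mathbb{C}P^3,g_a)$ is a smooth immersion into $\mathbb{C}P^3$ of a non-empty smooth manifold of dimension five. Let $h$ be its second fundamental form (the normal part of the Levi-Civita connection of $g_a$ on tangent fields), and let $\nabla h$ be its covariant derivative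 with respect to the normal connection and the Levi-Civita connection of the induced metric. The hypersurface is called * Codazzi-like if $\nabla h$ is totally symmetric, parallel if $\nabla h=0$, totally geodesic if $h=0$; * totally umbilical if at each point, for a unit normal $N$, the form $(X,Y)\mapsto g_a(h(X,Y),N)$ is a multiple of $(X,Y)\mapsto g_a(X,Y)$ on tangent vectors; * of constant sectional curvature if there is a constant $c$ such that the curvature tensor $R^{\mathcal{H}}$ of the induced metric satisfies $R^{\mathcal{H}}(X,Y)Z=c\,\big(g_a(Y,Z)X-g_a(X,Z)Y\big)$ everywhere. **Theorem.** For every $a>0$, the space $(\mathbb{C}P^3,g_a)$ admits no hypersurface that is Codazzi-like, and so in particular none that is parallel or totally geodesic; no hypersurface that is totally umbilical; and no hypersurface of constant sectional curvature. -/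

import Mathlib

open scoped Manifold ContDiff LinearAlgebra.Projectivization

/-! ## Riemannian geometry of immersions in coordinates

A Riemannian metric on an open piece of a normed space `E` is a function `g` that sends a point to
a bilinear form. -/

namespace LocalRiemannian

noncomputable section

variable {E E' : Type*} [NormedAddCommGroup E] [NormedSpace ℝ E]
  [NormedAddCommGroup E'] [NormedSpace ℝ E']

/-- The Koszul expression `g(∇_u v, ·)` for constant coordinate fields `u`, `v` (Christoffel
symbols of the first kind). -/
def christoffelForm (g : E → E →L[ℝ] E →L[ℝ] ℝ) (x u v : E) : E →L[ℝ] ℝ :=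
  (1 / 2 : ℝ) •
    (fderiv ℝ g x u v + fderiv ℝ g x v u - ((fderiv ℝ g x).flip u).flip v)

/-- The vector field `∇_u v` of the Levi-Civita connection of `g`, for constant coordinate fields
`u`, `v`. The index is raised with the inverse of the isomorphism `E ≃ E*` given by `g x`. -/
def christoffel (g : E → E →L[ℝ] E →L[ℝ] ℝ) (x u v : E) : E :=
  (g x).inverse (christoffelForm g x u v)

/-- The Riemann curvature tensor `R(X,Y)Z = ∇_X ∇_Y Z - ∇_Y ∇_X Z - ∇_[X,Y] Z` of `g` at `x`. -/
def curvature (g : E → E →L[ℝ] E →L[ℝ] ℝ) (x X Y Z : E) : E :=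
  fderiv ℝ (fun y => christoffel g y Y Z) x X - fderiv ℝ (fun y => christoffel g y X Z) x Y
    + christoffel g x X (christoffel g x Y Z) - christoffel g x Y (christoffel g x X Z)

/-- The pull-back metric `F^* G`. -/
def pullbackMetric (G : E' → E' →L[ℝ] E' →L[ℝ] ℝ) (F : E → E') (x : E) : E →L[ℝ] E →L[ℝ] ℝ :=
  (G (F x)).bilinearComp (fderiv ℝ F x) (fderiv ℝ F x)

/-- The `G`-orthogonal projection of a vector `v` at `F x` to the normal space of the immersion `F`
at `x`: subtract the tangential part, which is determined by its products with tangent vectors. -/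
def normalPart (G : E' → E' →L[ℝ] E' →L[ℝ] ℝ) (F : E → E') (x : E) (v : E') : E' :=
  v - fderiv ℝ F x ((pullbackMetric G F x).inverse ((G (F x) v).comp (fderiv ℝ F x)))

/-- The ambient covariant derivative along `F`, at `x` in the direction `X`, of a vector field `V`
along `F`. -/
def covDerivAlong (G : E' → E' →L[ℝ] E' →L[ℝ] ℝ) (F : E → E') (V : E → E') (x X : E) : E' :=
  fderiv ℝ V x X + christoffel G (F x) (fderiv ℝ F x X) (V x)

/-- The second fundamental form: the normal part of the ambient Levi-Civita derivative of tangent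
fields. -/
def secondFundamentalForm (G : E' → E' →L[ℝ] E' →L[ℝ] ℝ) (F : E → E') (x X Y : E) : E' :=
  normalPart G F x (covDerivAlong G F (fun y => fderiv ℝ F y Y) x X)

/-- `(∇h)(X,Y,Z) = ∇^⊥_X (h(Y,Z)) - h(∇_X Y, Z) - h(Y, ∇_X Z)`, with the normal connection
`∇^⊥` and the Levi-Civita connection of the pull-back metric. -/
def derivSecondFundamentalForm (G : E' → E' →L[ℝ] E' →L[ℝ] ℝ) (F : E → E') (x X Y Z : E) : E' :=
  normalPart G F x (covDerivAlong G F (fun y => secondFundamentalForm G F y Y Z) x X)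
    - secondFundamentalForm G F x (christoffel (pullbackMetric G F) x X Y) Z
    - secondFundamentalForm G F x Y (christoffel (pullbackMetric G F) x X Z)

/-- `N` is a unit normal vector of the immersion `F` at `x`. -/
def IsUnitNormal (G : E' → E' →L[ℝ] E' →L[ℝ] ℝ) (F : E → E') (x : E) (N : E') : Prop :=
  G (F x) N N = 1 ∧ ∀ X : E, G (F x) (fderiv ℝ F x X) N = 0

/-- `∇h` is a totally symmetric tensor at `x`. -/
def IsCodazziAt (G : E' → E' →L[ℝ] E' →L[ℝ] ℝ) (F : E → E') (x : E) : Prop :=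
  ∀ X Y Z : E,
    derivSecondFundamentalForm G F x X Y Z = derivSecondFundamentalForm G F x Y X Z ∧
    derivSecondFundamentalForm G F x X Y Z = derivSecondFundamentalForm G F x X Z Y

/-- `∇h = 0` at `x`. -/
def IsParallelAt (G : E' → E' →L[ℝ] E' →L[ℝ] ℝ) (F : E → E') (x : E) : Prop :=
  ∀ X Y Z : E, derivSecondFundamentalForm G F x X Y Z = 0

/-- `h = 0` at `x`. -/
def IsTotallyGeodesicAt (G : E' → E' →L[ℝ] E' →L[ℝ] ℝ) (F : E → E') (x : E) : Prop :=
  ∀ X Y : E, secondFundamentalForm G F x X Y = 0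

/-- `g(h(X,Y),N)` is proportional to `g(X,Y)` at `x`, for every unit normal `N`. -/
def IsTotallyUmbilicalAt (G : E' → E' →L[ℝ] E' →L[ℝ] ℝ) (F : E → E') (x : E) : Prop :=
  ∀ N : E', IsUnitNormal G F x N → ∃ μ : ℝ, ∀ X Y : E,
    G (F x) (secondFundamentalForm G F x X Y) N = μ * pullbackMetric G F x X Y

/-- The intrinsic curvature satisfies `R(X,Y)Z = c (X ∧ Y) Z = c (g(Y,Z) X - g(X,Z) Y)` at `x`. -/
def HasSectionalCurvatureAt (G : E' → E' →L[ℝ] E' →L[ℝ] ℝ) (F : E → E') (c : ℝ) (x : E) : Prop :=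
  ∀ X Y Z : E, curvature (pullbackMetric G F) x X Y Z =
    c • (pullbackMetric G F x Y Z • X - pullbackMetric G F x X Z • Y)

end

end LocalRiemannian

/-! ## Complex projective three-space as a smooth manifold -/

/-- Complex projective three-space. -/
def CP3 : Type := ℙ ℂ (EuclideanSpace ℂ (Fin 4))

namespace CP3

noncomputable section

/-- The projection from the nonzero vectors of `ℂ⁴`; its restriction to the unit sphere is the Hopf
fibration. -/
def proj (v : {v : EuclideanSpace ℂ (Fin 4) // v ≠ 0}) : CP3 := Projectivization.mk' ℂ v

/-- The quotient topology. -/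
instance : TopologicalSpace CP3 := TopologicalSpace.coinduced proj inferInstance

/-- Affine coordinates `z ↦ (z_k / z_i)_{k ≠ i}`. -/
def affineCoord (i : Fin 4) (z : EuclideanSpace ℂ (Fin 4)) : Fin 3 → ℂ :=
  fun k => z (i.succAbove k) / z i

/-- Homogeneous coordinates of the point with affine coordinates `w`: a `1` is put in place `i`. -/
def homCoord (i : Fin 4) (w : Fin 3 → ℂ) : EuclideanSpace ℂ (Fin 4) :=
  WithLp.toLp 2 (i.insertNth (1 : ℂ) w)

@[simp] theorem homCoord_same (i : Fin 4) (w : Fin 3 → ℂ) : homCoord i w i = 1 := by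
  simp [homCoord]

@[simp] theorem homCoord_succAbove (i : Fin 4) (w : Fin 3 → ℂ) (k : Fin 3) :
    homCoord i w (i.succAbove k) = w k := by
  simp [homCoord]

theorem homCoord_ne_zero (i : Fin 4) (w : Fin 3 → ℂ) : homCoord i w ≠ 0 := by
  intro h
  have := congrArg (fun v : EuclideanSpace ℂ (Fin 4) => v i) h
  simp at this

theorem surjective_proj : Function.Surjective proj := fun x => by
  induction x using Projectivization.ind with
  | h v hv => exact ⟨⟨v, hv⟩, rfl⟩

theorem isQuotientMap_proj : Topology.IsQuotientMap proj := ⟨⟨rfl⟩, surjective_proj⟩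

theorem continuous_proj : Continuous proj := isQuotientMap_proj.continuous

theorem proj_eq_iff (v w : {v : EuclideanSpace ℂ (Fin 4) // v ≠ 0}) :
    proj v = proj w ↔ ∃ c : ℂˣ, c • (w : EuclideanSpace ℂ (Fin 4)) = v :=
  Projectivization.mk_eq_mk_iff ℂ _ _ v.2 w.2

theorem exists_rep (x : CP3) : ∃ v, proj v = x := surjective_proj x

/-- A choice of homogeneous coordinates. -/
def rep (x : CP3) : {v : EuclideanSpace ℂ (Fin 4) // v ≠ 0} := (exists_rep x).choose

theorem proj_rep (x : CP3) : proj (rep x) = x := (exists_rep x).choose_spec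

theorem exists_rep_proj (v : {v : EuclideanSpace ℂ (Fin 4) // v ≠ 0}) :
    ∃ c : ℂˣ, c • (v : EuclideanSpace ℂ (Fin 4)) = rep (proj v) :=
  (proj_eq_iff _ _).1 (proj_rep (proj v))

theorem rep_proj_ne_zero_iff (i : Fin 4) (v : {v : EuclideanSpace ℂ (Fin 4) // v ≠ 0}) :
    (rep (proj v)).1 i ≠ 0 ↔ v.1 i ≠ 0 := by
  obtain ⟨c, hc⟩ := exists_rep_proj v
  rw [← hc]
  simp [Units.smul_def]

theorem affineCoord_rep_proj (i : Fin 4) (v : {v : EuclideanSpace ℂ (Fin 4) // v ≠ 0}) :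
    affineCoord i (rep (proj v)).1 = affineCoord i v.1 := by
  obtain ⟨c, hc⟩ := exists_rep_proj v
  rw [← hc]
  funext k
  simp [affineCoord, Units.smul_def, mul_div_mul_left]

theorem continuous_homCoord (i : Fin 4) : Continuous (homCoord i) := by
  unfold homCoord
  fun_prop

theorem isOpen_affine (i : Fin 4) : IsOpen {x : CP3 | (rep x).1 i ≠ 0} := by
  rw [← isQuotientMap_proj.isOpen_preimage]
  have : proj ⁻¹' {x : CP3 | (rep x).1 i ≠ 0} = {v | v.1 i ≠ 0} := by
    ext v; exact rep_proj_ne_zero_iff i v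
  rw [this]
  exact isOpen_ne_fun (by fun_prop) continuous_const

/-- The affine chart `[z] ↦ (z_k / z_i)_{k ≠ i}`, defined where `z_i ≠ 0`. -/
def affineChart (i : Fin 4) : OpenPartialHomeomorph CP3 (Fin 3 → ℂ) where
  toFun x := affineCoord i (rep x).1
  invFun w := proj ⟨homCoord i w, homCoord_ne_zero i w⟩
  source := {x | (rep x).1 i ≠ 0}
  target := Set.univ
  map_source' _ _ := Set.mem_univ _
  map_target' w _ := by
    rw [Set.mem_ofPred_eq, rep_proj_ne_zero_iff]; simp
  left_inv' x hx := by
    rw [Set.mem_ofPred_eq] at hx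
    conv_rhs => rw [← proj_rep x]
    rw [proj_eq_iff]
    refine ⟨(Units.mk0 _ hx)⁻¹, ?_⟩
    ext k
    rcases Fin.eq_self_or_eq_succAbove i k with rfl | ⟨j, rfl⟩
    · simp [Units.smul_def, hx]
    · simp [Units.smul_def, affineCoord, div_eq_inv_mul]
  right_inv' w _ := by
    rw [affineCoord_rep_proj]
    funext k
    simp [affineCoord]
  open_source := isOpen_affine i
  open_target := isOpen_univ
  continuousOn_toFun := by
    have hq := isQuotientMap_proj.restrictPreimage_isOpen (isOpen_affine i)
    rw [continuousOn_iff_continuous_domRestrict, hq.continuous_iff]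
    have : (Set.domRestrict {x : CP3 | (rep x).1 i ≠ 0} fun x => affineCoord i (rep x).1) ∘
        (Set.restrictPreimage {x : CP3 | (rep x).1 i ≠ 0} proj) =
        fun v => affineCoord i v.1.1 := by
      funext v
      exact affineCoord_rep_proj i v.1
    rw [this]
    refine continuous_pi fun k => Continuous.div (by fun_prop) (by fun_prop) ?_
    intro v
    exact (rep_proj_ne_zero_iff i v.1).1 v.2
  continuousOn_invFun :=
    (continuous_proj.comp ((continuous_homCoord i).subtype_mk _)).continuousOn

theorem exists_mem_affineChart (x : CP3) : ∃ i, x ∈ (affineChart i).source := by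
  by_contra! h
  refine (rep x).2 ?_
  ext i
  simpa [affineChart] using h i

instance : ChartedSpace (Fin 3 → ℂ) CP3 where
  atlas := Set.range affineChart
  chartAt x := affineChart (exists_mem_affineChart x).choose
  mem_chart_source x := (exists_mem_affineChart x).choose_spec
  chart_mem_atlas _ := ⟨_, rfl⟩

instance : IsManifold 𝓘(ℝ, Fin 3 → ℂ) ∞ CP3 := by
  apply isManifold_of_contDiffOn
  rintro _ _ ⟨i, rfl⟩ ⟨j, rfl⟩
  have h1 : ∀ w : Fin 3 → ℂ, affineChart j ((affineChart i).symm w) =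
      affineCoord j (homCoord i w) := fun w => affineCoord_rep_proj j ⟨_, homCoord_ne_zero i w⟩
  have h2 : ∀ w : Fin 3 → ℂ, (affineChart i).symm w ∈ (affineChart j).source ↔
      homCoord i w j ≠ 0 := fun w => rep_proj_ne_zero_iff j ⟨_, homCoord_ne_zero i w⟩
  have h3 : ∀ k, ContDiff ℝ ∞ fun w : Fin 3 → ℂ => homCoord i w k := by
    intro k
    rcases Fin.eq_self_or_eq_succAbove i k with rfl | ⟨l, rfl⟩
    · simpa using contDiff_const
    · simpa using contDiff_apply ℝ ℂ l
  have h4 : ContDiffOn ℝ ∞ (fun w => affineCoord j (homCoord i w))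
      {w | homCoord i w j ≠ 0} := by
    rw [contDiffOn_pi]
    intro k
    simp only [affineCoord, div_eq_mul_inv]
    exact (h3 _).contDiffOn.mul ((h3 j).contDiffOn.inv fun w hw => hw)
  refine (h4.congr fun w _ => ?_).mono ?_
  · exact h1 w
  · intro w hw
    simp only [mfld_simps] at hw
    exact (h2 w).1 hw.2

/-! ## The homogeneous metrics -/

/-- Left multiplication by the quaternion `j` on `ℍ² = ℂ⁴`, where `(z₀, z₁, z₂, z₃)` is
`(z₀ + z₁ j, z₂ + z₃ j)`. -/
def jMul (p : EuclideanSpace ℂ (Fin 4)) : EuclideanSpace ℂ (Fin 4) :=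
  !₂[-star (p 1), star (p 0), -star (p 3), star (p 2)]

/-- For a unit vector `v`, the orthogonal projection to the complex line spanned by `v`. -/
def lineProj (v : EuclideanSpace ℂ (Fin 4)) :
    EuclideanSpace ℂ (Fin 4) →L[ℂ] EuclideanSpace ℂ (Fin 4) :=
  (innerSL ℂ v).smulRight v

/-- The differential of `homCoord i`: a `0` is put in place `i`. -/
def homDir (i : Fin 4) : (Fin 3 → ℂ) →L[ℂ] EuclideanSpace ℂ (Fin 4) :=
  LinearMap.toContinuousLinearMap
    { toFun := fun u => WithLp.toLp 2 (i.insertNth (0 : ℂ) u)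
      map_add' := fun u v => by
        ext k
        rcases Fin.eq_self_or_eq_succAbove i k with rfl | ⟨l, rfl⟩ <;> simp
      map_smul' := fun c u => by
        ext k
        rcases Fin.eq_self_or_eq_succAbove i k with rfl | ⟨l, rfl⟩ <;> simp }

/-- The point of the unit sphere of `ℂ⁴` over the point with affine coordinates `w`. -/
def spherePoint (i : Fin 4) (w : Fin 3 → ℂ) : EuclideanSpace ℂ (Fin 4) :=
  (‖homCoord i w‖⁻¹ : ℂ) • homCoord i w

/-- The horizontal lift for the Hopf fibration, at `spherePoint i w`, of tangent vectors of `CP3`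
written in the affine chart `i`. -/
def horizontalLift (i : Fin 4) (w : Fin 3 → ℂ) : (Fin 3 → ℂ) →L[ℂ] EuclideanSpace ℂ (Fin 4) :=
  (‖homCoord i w‖⁻¹ : ℂ) •
    (ContinuousLinearMap.id ℂ _ - lineProj (spherePoint i w)).comp (homDir i)

/-- The almost product structure at the unit vector `p`, on horizontal vectors: `-1` on
`𝓓₁ = span_ℝ {jp, kp} = span_ℂ {jp}` and `1` on `𝓓₂`, the orthogonal complement of
`span_ℝ {p, ip, jp, kp}`. -/
def almostProduct (p : EuclideanSpace ℂ (Fin 4)) :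
    EuclideanSpace ℂ (Fin 4) →L[ℂ] EuclideanSpace ℂ (Fin 4) :=
  ContinuousLinearMap.id ℂ _ - (2 : ℂ) • lineProj (jMul p)

/-- The metric `g_a(X,Y) = (1+a)/2 g₁(X,Y) + (a-1)/2 g₁(PX,Y)` in the affine chart `i`, where `g₁` is
the Fubini-Study metric, for which the Hopf fibration is a Riemannian submersion. -/
def metric (a : ℝ) (i : Fin 4) (w : Fin 3 → ℂ) : (Fin 3 → ℂ) →L[ℝ] (Fin 3 → ℂ) →L[ℝ] ℝ :=
  ((1 + a) / 2) •
    (innerSL ℝ).bilinearComp ((horizontalLift i w).restrictScalars ℝ)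
      ((horizontalLift i w).restrictScalars ℝ) +
  ((a - 1) / 2) •
    (innerSL ℝ).bilinearComp
      (((almostProduct (spherePoint i w)).comp (horizontalLift i w)).restrictScalars ℝ)
      ((horizontalLift i w).restrictScalars ℝ)

theorem norm_spherePoint (i : Fin 4) (w : Fin 3 → ℂ) : ‖spherePoint i w‖ = 1 := by
  have := norm_ne_zero_iff.2 (homCoord_ne_zero i w)
  simp [spherePoint, norm_smul, this]

theorem norm_jMul (p : EuclideanSpace ℂ (Fin 4)) : ‖jMul p‖ = ‖p‖ := by
  simp only [EuclideanSpace.norm_eq, Fin.sum_univ_four, jMul]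
  simp
  congr 1
  ring

@[simp] theorem homDir_same (i : Fin 4) (u : Fin 3 → ℂ) : homDir i u i = 0 := by
  simp [homDir]

@[simp] theorem homDir_succAbove (i : Fin 4) (u : Fin 3 → ℂ) (k : Fin 3) :
    homDir i u (i.succAbove k) = u k := by
  simp [homDir]

theorem horizontalLift_apply (i : Fin 4) (w u : Fin 3 → ℂ) :
    horizontalLift i w u = (‖homCoord i w‖⁻¹ : ℂ) •
      (homDir i u - inner ℂ (spherePoint i w) (homDir i u) • spherePoint i w) := by
  simp [horizontalLift, lineProj]

/-- Horizontal lifts are orthogonal to `p` and `ip`, where `p = spherePoint i w`. -/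
theorem inner_horizontalLift (i : Fin 4) (w u : Fin 3 → ℂ) :
    inner ℂ (spherePoint i w) (horizontalLift i w u) = 0 := by
  rw [horizontalLift_apply, inner_smul_right, inner_sub_right, inner_smul_right,
    inner_self_eq_norm_sq_to_K, norm_spherePoint]
  simp

/-- The projection to `CP3`, in the affine chart `i`, maps the lift of `u` to `u`. -/
theorem hasDerivAt_affineCoord_horizontalLift (i : Fin 4) (w u : Fin 3 → ℂ) :
    HasDerivAt (fun t : ℝ => affineCoord i (spherePoint i w + t • horizontalLift i w u)) u 0 := by
  have hn := norm_ne_zero_iff.2 (homCoord_ne_zero i w)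
  have hc : (‖homCoord i w‖ : ℂ) ≠ 0 := by exact_mod_cast hn
  have hlin : ∀ α β : ℂ, HasDerivAt (fun t : ℝ => α + t • β) β 0 := fun α β => by
    simpa using ((hasDerivAt_id (0 : ℝ)).smul_const β).const_add α
  rw [hasDerivAt_pi]
  intro k
  have h := (hlin (spherePoint i w (i.succAbove k))
    (horizontalLift i w u (i.succAbove k))).div
    (hlin (spherePoint i w i) (horizontalLift i w u i)) (by simp [spherePoint, hn])
  refine h.congr_deriv ?_
  rw [horizontalLift_apply]
  generalize inner ℂ (spherePoint i w) (homDir i u) = s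
  simp [spherePoint]
  field_simp
  ring

theorem metric_apply (a : ℝ) (i : Fin 4) (w u v : Fin 3 → ℂ) :
    metric a i w u v =
      (1 + a) / 2 * inner ℝ (horizontalLift i w u) (horizontalLift i w v) +
      (a - 1) / 2 *
        inner ℝ (almostProduct (spherePoint i w) (horizontalLift i w u))
          (horizontalLift i w v) := by
  simp [metric]

/-- `g_a` is positive definite for `a > 0`. -/
theorem metric_pos (a : ℝ) (ha : 0 < a) (i : Fin 4) (w u : Fin 3 → ℂ) (hu : u ≠ 0) :
    0 < metric a i w u u := by
  have hU : horizontalLift i w u ≠ 0 := by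
    intro h
    apply hu
    have h1 := hasDerivAt_affineCoord_horizontalLift i w u
    rw [h] at h1
    simp only [smul_zero, add_zero] at h1
    exact h1.unique (hasDerivAt_const _ _)
  rw [metric_apply]
  set U := horizontalLift i w u
  set q := jMul (spherePoint i w)
  have hq : ‖q‖ = 1 := by rw [norm_jMul, norm_spherePoint]
  have hre : ∀ x y : EuclideanSpace ℂ (Fin 4), inner ℝ x y = (inner ℂ x y).re := by
    intro x y
    simp [PiLp.inner_apply, Complex.inner]
  have hP : inner ℝ (almostProduct (spherePoint i w) U) U = ‖U‖ ^ 2 - 2 * ‖inner ℂ q U‖ ^ 2 := by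
    rw [hre]
    have : almostProduct (spherePoint i w) U = U - ((2 : ℂ) * inner ℂ q U) • q := by
      simp [almostProduct, lineProj, q, smul_smul]
    rw [this, inner_sub_left, inner_smul_left, inner_self_eq_norm_sq_to_K, map_mul, mul_assoc,
      Complex.conj_mul']
    norm_cast
    simp [← Complex.ofReal_pow]
  have hle : ‖inner ℂ q U‖ ≤ ‖U‖ := by simpa [hq] using norm_inner_le_norm (𝕜 := ℂ) q U
  have hpos : 0 < ‖U‖ := norm_pos_iff.2 hU
  rw [hP, real_inner_self_eq_norm_sq]
  have h0 := norm_nonneg (inner ℂ q U)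
  have h2 : ‖inner ℂ q U‖ ^ 2 ≤ ‖U‖ ^ 2 := by gcongr
  have h3 : 0 < ‖U‖ ^ 2 := by positivity
  have h4 : 0 ≤ ‖inner ℂ q U‖ ^ 2 := by positivity
  rcases le_total a 1 with h | h
  · nlinarith
  · nlinarith

/-- `g_a` is symmetric. -/
theorem metric_comm (a : ℝ) (i : Fin 4) (w u v : Fin 3 → ℂ) :
    metric a i w u v = metric a i w v u := by
  have hre : ∀ x y : EuclideanSpace ℂ (Fin 4), inner ℝ x y = (inner ℂ x y).re := by
    intro x y
    simp [PiLp.inner_apply, Complex.inner]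
  rw [metric_apply, metric_apply, real_inner_comm]
  congr 2
  simp only [hre, almostProduct, lineProj]
  simp [smul_smul]
  generalize horizontalLift i w u = U
  generalize horizontalLift i w v = V
  rw [← inner_conj_symm U V, ← inner_conj_symm U (jMul _), ← inner_conj_symm V (jMul _)]
  simp only [Complex.conj_re, Complex.conj_im]
  ring

end

end CP3

/-! ## Hypersurfaces of `(CP3, g_a)` -/

namespace CP3Hypersurface

noncomputable section

variable {M : Type*} [TopologicalSpace M] [ChartedSpace (EuclideanSpace ℝ (Fin 5)) M]

/-- The map `f : M → CP3` is a smooth immersion. -/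
def IsImmersedHypersurface (f : M → CP3) : Prop :=
  ContMDiff 𝓘(ℝ, EuclideanSpace ℝ (Fin 5)) 𝓘(ℝ, Fin 3 → ℂ) ∞ f ∧
    ∀ m : M, Function.Injective
      (mfderiv 𝓘(ℝ, EuclideanSpace ℝ (Fin 5)) 𝓘(ℝ, Fin 3 → ℂ) f m)

/-- A pointwise property `Q` of coordinate expressions of immersions into a Riemannian space holds
for `f : M → (CP3, g_a)` at all points, in all smooth charts of `M` and all affine charts of
`CP3`. -/
def InCharts (a : ℝ) (f : M → CP3)
    (Q : ((Fin 3 → ℂ) → (Fin 3 → ℂ) →L[ℝ] (Fin 3 → ℂ) →L[ℝ] ℝ) →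
      (EuclideanSpace ℝ (Fin 5) → (Fin 3 → ℂ)) → EuclideanSpace ℝ (Fin 5) → Prop) : Prop :=
  ∀ e ∈ IsManifold.maximalAtlas 𝓘(ℝ, EuclideanSpace ℝ (Fin 5)) ∞ M, ∀ i : Fin 4,
    ∀ x ∈ e.target, f (e.symm x) ∈ (CP3.affineChart i).source →
      Q (CP3.metric a i) (CP3.affineChart i ∘ f ∘ e.symm) x

/-- `∇h` is totally symmetric. -/
def IsCodazzi (a : ℝ) (f : M → CP3) : Prop := InCharts a f LocalRiemannian.IsCodazziAt

/-- `∇h = 0`. -/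
def IsParallel (a : ℝ) (f : M → CP3) : Prop := InCharts a f LocalRiemannian.IsParallelAt

/-- `h = 0`. -/
def IsTotallyGeodesic (a : ℝ) (f : M → CP3) : Prop :=
  InCharts a f LocalRiemannian.IsTotallyGeodesicAt

/-- The second fundamental form is at each point proportional to the metric. -/
def IsTotallyUmbilical (a : ℝ) (f : M → CP3) : Prop :=
  InCharts a f LocalRiemannian.IsTotallyUmbilicalAt

/-- The induced metric has constant sectional curvature, with one constant for all of `M`. -/
def HasConstantSectionalCurvature (a : ℝ) (f : M → CP3) : Prop :=
  ∃ c : ℝ, InCharts a f fun G F x => LocalRiemannian.HasSectionalCurvatureAt G F c x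

end

end CP3Hypersurface

/-! The group Sp(2) of left-ℍ-linear isometries of ℂ⁴ = ℍ² acts isometrically for every g_a.
Combined with a change of phase along the Hopf fibre, it carries any point and any tangent vector N
there to the centre of the affine chart `0` and to (r, s, 0) with r, s real: r is the 𝓓₁-component
and s the 𝓓₂-component (`exists_adapted_isometry`). Pointwise questions about a hypersurface with
normal N thus become questions about one explicit tensor, `centralCurvature`.

Codazzi-like and umbilical hypersurfaces. By the Codazzi equation, g(R(X,Y)Z, N) vanishes if ∇h is
symmetric; if h = g ⊗ H it vanishes whenever Z is orthogonal to X and Y. At the centre one such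
component equals -s (`centralCurvature_normal`), so N lies in 𝓓₁ at every point. The holomorphic
contact form θ = σ(z, dz), whose kernel is 𝓓₂, then takes values on a single real line of ℂ at each
point of the hypersurface. Differentiating Im(θ̄(X) θ(Y)) = 0 shows that dθ on ker θ takes values on
the same line. But ker θ is now all of 𝓓₂, on which dθ is a nondegenerate complex bilinear form: a
contradiction. Parallel is a special case of Codazzi-like, totally geodesic of umbilical.

Constant curvature. This case is algebra at a single point (`not_gauss_constant_curvature`). The
Gauss equation prescribes all 2×2 minors of the symmetric matrix of h as curvature plus c times the
minors of the metric, and minors satisfy polynomial identities. If r ≠ 0, two Plücker relations give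
3r = 0. If r = 0, two Laplace expansions of one determinant give c a² = 1; Plücker relations then
leave only a = 1/2, c = 4, where the square of a 3×3 determinant would be -4. -/

/-! ### Levi-Civita connection and curvature of a metric in coordinates -/

namespace LocalRiemannian

noncomputable section

set_option maxSynthPendingDepth 3
set_option linter.unusedSectionVars false

variable {E E' : Type*} [NormedAddCommGroup E] [NormedSpace ℝ E]
  [NormedAddCommGroup E'] [NormedSpace ℝ E']

/-- `g` is a smooth Riemannian metric on the open set `U`. -/
structure IsRiemannianOn (g : E → E →L[ℝ] E →L[ℝ] ℝ) (U : Set E) : Prop where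
  isOpen : IsOpen U
  contDiffOn : ContDiffOn ℝ ∞ g U
  symm : ∀ x ∈ U, ∀ u v, g x u v = g x v u
  pos : ∀ x ∈ U, ∀ u, u ≠ 0 → 0 < g x u u

/-- `F` is a smooth immersion on the open set `U`. -/
structure IsImmersionOn (F : E → E') (U : Set E) : Prop where
  isOpen : IsOpen U
  contDiffOn : ContDiffOn ℝ ∞ F U
  injective : ∀ x ∈ U, Function.Injective (fderiv ℝ F x)

/-- Positivity makes B injective into the dual space, which has the same dimension. Invertibility
guarantees that `ContinuousLinearMap.inverse`, used to raise indices, does not take its default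
value 0. -/
theorem isInvertible_of_pos [FiniteDimensional ℝ E] {B : E →L[ℝ] E →L[ℝ] ℝ}
    (hB : ∀ u, u ≠ 0 → 0 < B u u) : B.IsInvertible := by
  let L : E →ₗ[ℝ] Module.Dual ℝ E :=
    (LinearMap.toContinuousLinearMap (𝕜 := ℝ) (E := E) (F' := ℝ)).symm.toLinearMap ∘ₗ B.toLinearMap
  have hL : Function.Injective L := by
    rw [← LinearMap.ker_eq_bot, LinearMap.ker_eq_bot']
    intro u hu
    by_contra h
    have h1 := hB u h
    have h2 : L u u = B u u := rfl
    rw [hu] at h2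
    simp at h2
    linarith
  let e := LinearEquiv.ofInjectiveOfFinrankEq L hL Subspace.dual_finrank_eq.symm
  let e' := (e.trans (LinearMap.toContinuousLinearMap (𝕜 := ℝ) (E := E) (F' := ℝ)))
  refine ⟨e'.toContinuousLinearEquiv, ?_⟩
  ext u v
  rfl

section

variable {g : E → E →L[ℝ] E →L[ℝ] ℝ} {U : Set E} {x : E}

theorem IsRiemannianOn.ext (hg : IsRiemannianOn g U) (hx : x ∈ U) {u v : E}
    (h : ∀ w, g x u w = g x v w) : u = v := by
  by_contra hne
  have := hg.pos x hx (u - v) (sub_ne_zero.2 hne)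
  simp [h] at this

theorem IsRiemannianOn.contDiffAt (hg : IsRiemannianOn g U) (hx : x ∈ U) : ContDiffAt ℝ ∞ g x :=
  hg.contDiffOn.contDiffAt (hg.isOpen.mem_nhds hx)

theorem IsRiemannianOn.differentiableAt (hg : IsRiemannianOn g U) (hx : x ∈ U) :
    DifferentiableAt ℝ g x :=
  (hg.contDiffAt hx).differentiableAt (by simp)

theorem fderiv_apply_apply {g : E → E →L[ℝ] E →L[ℝ] ℝ} (hg : DifferentiableAt ℝ g x) (u v w : E) :
    fderiv ℝ (fun y => g y v w) x u = fderiv ℝ g x u v w := by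
  have h1 : HasFDerivAt (fun y => g y v w) _ x :=
    (hg.hasFDerivAt.clm_apply (hasFDerivAt_const v x)).clm_apply (hasFDerivAt_const w x)
  rw [h1.fderiv]
  simp

theorem IsRiemannianOn.fderiv_symm (hg : IsRiemannianOn g U) (hx : x ∈ U) (u v w : E) :
    fderiv ℝ g x u v w = fderiv ℝ g x u w v := by
  rw [← fderiv_apply_apply (hg.differentiableAt hx), ← fderiv_apply_apply (hg.differentiableAt hx)]
  have : (fun y => g y v w) =ᶠ[nhds x] fun y => g y w v := by
    filter_upwards [hg.isOpen.mem_nhds hx] with y hy using hg.symm y hy v w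
  rw [this.fderiv_eq]

theorem christoffelForm_apply (g : E → E →L[ℝ] E →L[ℝ] ℝ) (x u v w : E) :
    christoffelForm g x u v w =
      1 / 2 * (fderiv ℝ g x u v w + fderiv ℝ g x v u w - fderiv ℝ g x w u v) := by
  simp [christoffelForm]

variable [FiniteDimensional ℝ E]

theorem IsRiemannianOn.apply_inverse (hg : IsRiemannianOn g U) (hx : x ∈ U) (φ : E →L[ℝ] ℝ) :
    g x ((g x).inverse φ) = φ :=
  (isInvertible_of_pos (hg.pos x hx)).self_apply_inverse φ

theorem IsRiemannianOn.apply_christoffel (hg : IsRiemannianOn g U) (hx : x ∈ U) (u v w : E) :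
    g x (christoffel g x u v) w =
      1 / 2 * (fderiv ℝ g x u v w + fderiv ℝ g x v u w - fderiv ℝ g x w u v) := by
  rw [christoffel, hg.apply_inverse hx, christoffelForm_apply]

theorem IsRiemannianOn.christoffel_comm (hg : IsRiemannianOn g U) (hx : x ∈ U) (u v : E) :
    christoffel g x u v = christoffel g x v u := by
  refine hg.ext hx fun w => ?_
  rw [hg.apply_christoffel hx, hg.apply_christoffel hx, hg.fderiv_symm hx w u v]
  ring

/-- Metric compatibility ∇g = 0: in the sum of the two Koszul expressions all terms cancel except
the two that differentiate in direction u. -/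
theorem IsRiemannianOn.fderiv_eq (hg : IsRiemannianOn g U) (hx : x ∈ U) (u v w : E) :
    fderiv ℝ g x u v w = g x (christoffel g x u v) w + g x v (christoffel g x u w) := by
  rw [hg.symm x hx v, hg.apply_christoffel hx, hg.apply_christoffel hx, hg.fderiv_symm hx u w v]
  ring

/-- The Christoffel symbols as a bundled bilinear map. -/
def christoffelL (g : E → E →L[ℝ] E →L[ℝ] ℝ) (x : E) : E →L[ℝ] E →L[ℝ] E :=
  LinearMap.toContinuousLinearMap
    { toFun := fun u => LinearMap.toContinuousLinearMap
        { toFun := fun v => christoffel g x u v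
          map_add' := fun v w => by
            rw [christoffel, christoffel, christoffel, ← map_add]
            congr 1
            ext z
            simp [christoffelForm_apply]
            ring
          map_smul' := fun c v => by
            rw [christoffel, christoffel, RingHom.id_apply, ← map_smul]
            congr 1
            ext z
            simp [christoffelForm_apply]
            ring }
      map_add' := fun u w => by
        ext v
        simp only [LinearMap.coe_toContinuousLinearMap', LinearMap.coe_mk, AddHom.coe_mk,
          add_apply]
        rw [christoffel, christoffel, christoffel, ← map_add]
        congr 1
        ext z
        simp [christoffelForm_apply]
        ring
      map_smul' := fun c u => by
        ext v
        simp only [LinearMap.coe_toContinuousLinearMap', LinearMap.coe_mk, AddHom.coe_mk,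
          smul_apply, RingHom.id_apply]
        rw [christoffel, christoffel, ← map_smul]
        congr 1
        ext z
        simp [christoffelForm_apply]
        ring }

@[simp] theorem christoffelL_apply (g : E → E →L[ℝ] E →L[ℝ] ℝ) (x u v : E) :
    christoffelL g x u v = christoffel g x u v := rfl

theorem IsRiemannianOn.contDiffOn_christoffel (hg : IsRiemannianOn g U) (u v : E) :
    ContDiffOn ℝ ∞ (fun x => christoffel g x u v) U := by
  have hD : ContDiffOn ℝ ∞ (fderiv ℝ g) U := hg.contDiffOn.fderiv_of_isOpen hg.isOpen (by simp)
  have hD' : ∀ a b c : E, ContDiffOn ℝ ∞ (fun x => fderiv ℝ g x a b c) U := fun a b c =>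
    ((hD.clm_apply contDiffOn_const).clm_apply contDiffOn_const).clm_apply contDiffOn_const
  have hK : ContDiffOn ℝ ∞ (fun x => christoffelForm g x u v) U := by
    rw [contDiffOn_clm_apply]
    intro w
    simp only [christoffelForm_apply]
    exact contDiffOn_const.mul (((hD' _ _ _).add (hD' _ _ _)).sub (hD' _ _ _))
  have hI : ContDiffOn ℝ ∞ (fun x => (g x).inverse) U := by
    intro x hx
    obtain ⟨e, he⟩ := isInvertible_of_pos (hg.pos x hx)
    have h1 := contDiffAt_map_inverse (n := ∞) e
    rw [he] at h1
    exact (h1.comp x (hg.contDiffAt hx)).contDiffWithinAt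
  exact hI.clm_apply hK

theorem IsRiemannianOn.contDiffOn_christoffelL (hg : IsRiemannianOn g U) :
    ContDiffOn ℝ ∞ (christoffelL g) U := by
  rw [contDiffOn_clm_apply]
  intro u
  rw [contDiffOn_clm_apply]
  intro v
  exact hg.contDiffOn_christoffel u v

theorem IsRiemannianOn.hasFDerivAt_christoffelL (hg : IsRiemannianOn g U) (hx : x ∈ U) :
    HasFDerivAt (christoffelL g) (fderiv ℝ (christoffelL g) x) x :=
  ((hg.contDiffOn_christoffelL.contDiffAt (hg.isOpen.mem_nhds hx)).differentiableAt
    (by simp)).hasFDerivAt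

theorem IsRiemannianOn.curvature_eq (hg : IsRiemannianOn g U) (hx : x ∈ U) (X Y Z : E) :
    curvature g x X Y Z = fderiv ℝ (christoffelL g) x X Y Z - fderiv ℝ (christoffelL g) x Y X Z
      + christoffel g x X (christoffel g x Y Z) - christoffel g x Y (christoffel g x X Z) := by
  have h : ∀ A B : E, fderiv ℝ (fun y => christoffel g y A Z) x B =
      fderiv ℝ (christoffelL g) x B A Z := by
    intro A B
    have h1 : HasFDerivAt (fun y => christoffelL g y A Z) _ x :=
      ((hg.hasFDerivAt_christoffelL hx).clm_apply (hasFDerivAt_const A x)).clm_apply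
        (hasFDerivAt_const Z x)
    simp only [christoffelL_apply] at h1
    rw [h1.fderiv]
    simp
  rw [curvature, h, h]

/-- The curvature in terms of the metric coefficients. -/
theorem IsRiemannianOn.apply_curvature (hg : IsRiemannianOn g U) (hx : x ∈ U) (X Y Z W : E) :
    g x (curvature g x X Y Z) W =
      fderiv ℝ (fun y => christoffelForm g y Y Z W) x X
        - fderiv ℝ (fun y => christoffelForm g y X Z W) x Y
        - g x (christoffel g x Y Z) (christoffel g x X W)
        + g x (christoffel g x X Z) (christoffel g x Y W) := by
  have h : ∀ A B : E, fderiv ℝ (fun y => christoffelForm g y A Z W) x B =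
      g x (fderiv ℝ (fun y => christoffel g y A Z) x B) W
        + g x (christoffel g x B (christoffel g x A Z)) W
        + g x (christoffel g x A Z) (christoffel g x B W) := by
    intro A B
    have h1 : (fun y => christoffelForm g y A Z W) =ᶠ[nhds x]
        fun y => g y (christoffel g y A Z) W := by
      filter_upwards [hg.isOpen.mem_nhds hx] with y hy
      rw [hg.apply_christoffel hy, christoffelForm_apply]
    have h2 : HasFDerivAt (fun y => christoffel g y A Z) _ x :=
      (((hg.contDiffOn_christoffel A Z).contDiffAt (hg.isOpen.mem_nhds hx)).differentiableAt
        (by simp)).hasFDerivAt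
    have h3 := ((hg.differentiableAt hx).hasFDerivAt.clm_apply h2).clm_apply (hasFDerivAt_const W x)
    rw [h1.fderiv_eq, h3.fderiv, add_assoc, ← hg.fderiv_eq hx]
    simp
  rw [h, h, curvature]
  simp
  ring

end

end

end LocalRiemannian

/-! ### Covariant derivatives along an immersion and the Gauss formula -/

namespace LocalRiemannian

noncomputable section

set_option maxSynthPendingDepth 3
set_option linter.unusedSectionVars false

variable {E E' : Type*} [NormedAddCommGroup E] [NormedSpace ℝ E]
  [NormedAddCommGroup E'] [NormedSpace ℝ E']
  {G : E' → E' →L[ℝ] E' →L[ℝ] ℝ} {F : E → E'} {U : Set E} {x : E}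

@[simp] theorem pullbackMetric_apply (G : E' → E' →L[ℝ] E' →L[ℝ] ℝ) (F : E → E') (x u v : E) :
    pullbackMetric G F x u v = G (F x) (fderiv ℝ F x u) (fderiv ℝ F x v) := rfl

theorem IsImmersionOn.contDiffAt (hF : IsImmersionOn F U) (hx : x ∈ U) : ContDiffAt ℝ ∞ F x :=
  hF.contDiffOn.contDiffAt (hF.isOpen.mem_nhds hx)

theorem IsImmersionOn.hasFDerivAt (hF : IsImmersionOn F U) (hx : x ∈ U) :
    HasFDerivAt F (fderiv ℝ F x) x :=
  ((hF.contDiffAt hx).differentiableAt (by simp)).hasFDerivAt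

theorem IsImmersionOn.contDiffOn_fderiv (hF : IsImmersionOn F U) :
    ContDiffOn ℝ ∞ (fderiv ℝ F) U :=
  hF.contDiffOn.fderiv_of_isOpen hF.isOpen (by simp)

theorem IsImmersionOn.hasFDerivAt_fderiv (hF : IsImmersionOn F U) (hx : x ∈ U) :
    HasFDerivAt (fderiv ℝ F) (fderiv ℝ (fderiv ℝ F) x) x :=
  ((hF.contDiffOn_fderiv.contDiffAt (hF.isOpen.mem_nhds hx)).differentiableAt (by simp)).hasFDerivAt

theorem IsImmersionOn.hasFDerivAt_fderiv_apply (hF : IsImmersionOn F U) (hx : x ∈ U) (Y : E) :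
    HasFDerivAt (fun y => fderiv ℝ F y Y) ((fderiv ℝ (fderiv ℝ F) x).flip Y) x := by
  simpa using (hF.hasFDerivAt_fderiv hx).clm_apply (hasFDerivAt_const Y x)

theorem IsImmersionOn.fderiv_fderiv_comm (hF : IsImmersionOn F U) (hx : x ∈ U) (u v : E) :
    fderiv ℝ (fderiv ℝ F) x u v = fderiv ℝ (fderiv ℝ F) x v u :=
  (hF.contDiffAt hx).isSymmSndFDerivAt (by simpa using ENat.LEInfty.out) u v

theorem covDerivAlong_fderiv (hF : IsImmersionOn F U) (hx : x ∈ U) (X Y : E) :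
    covDerivAlong G F (fun y => fderiv ℝ F y Y) x X =
      fderiv ℝ (fderiv ℝ F) x X Y + christoffel G (F x) (fderiv ℝ F x X) (fderiv ℝ F x Y) := by
  rw [covDerivAlong, (hF.hasFDerivAt_fderiv_apply hx Y).fderiv]
  rfl

theorem covDerivAlong_congr {V W : E → E'} (h : V =ᶠ[nhds x] W) (X : E) :
    covDerivAlong G F V x X = covDerivAlong G F W x X := by
  rw [covDerivAlong, covDerivAlong, h.fderiv_eq, h.eq_of_nhds]

theorem fderiv_pullbackMetric (hG : IsRiemannianOn G Set.univ) (hF : IsImmersionOn F U)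
    (hx : x ∈ U) (hg : DifferentiableAt ℝ (pullbackMetric G F) x) (u v w : E) :
    fderiv ℝ (pullbackMetric G F) x u v w =
      fderiv ℝ G (F x) (fderiv ℝ F x u) (fderiv ℝ F x v) (fderiv ℝ F x w)
        + G (F x) (fderiv ℝ (fderiv ℝ F) x u v) (fderiv ℝ F x w)
        + G (F x) (fderiv ℝ F x v) (fderiv ℝ (fderiv ℝ F) x u w) := by
  rw [← fderiv_apply_apply hg]
  have h1 : HasFDerivAt (fun y => G (F y)) _ x :=
    (hG.differentiableAt (Set.mem_univ (F x))).hasFDerivAt.comp x (hF.hasFDerivAt hx)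
  have h2 := (h1.clm_apply (hF.hasFDerivAt_fderiv_apply hx v)).clm_apply
    (hF.hasFDerivAt_fderiv_apply hx w)
  simp only [pullbackMetric_apply]
  rw [h2.fderiv]
  simp
  ring

section

variable [FiniteDimensional ℝ E] [FiniteDimensional ℝ E']

theorem IsImmersionOn.isRiemannianOn_pullback (hF : IsImmersionOn F U)
    (hG : IsRiemannianOn G Set.univ) : IsRiemannianOn (pullbackMetric G F) U where
  isOpen := hF.isOpen
  contDiffOn := by
    rw [contDiffOn_clm_apply]
    intro u
    rw [contDiffOn_clm_apply]
    intro v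
    have hD : ∀ u, ContDiffOn ℝ ∞ (fun y => fderiv ℝ F y u) U := fun u =>
      hF.contDiffOn_fderiv.clm_apply contDiffOn_const
    exact ((hG.contDiffOn.comp hF.contDiffOn (Set.mapsTo_univ _ _)).clm_apply (hD u)).clm_apply
      (hD v)
  symm x _ u v := hG.symm _ (Set.mem_univ _) _ _
  pos x hx u hu := hG.pos _ (Set.mem_univ _) _ fun h =>
    hu (hF.injective x hx (h.trans (map_zero _).symm))

theorem apply_normalPart_fderiv (hG : IsRiemannianOn G Set.univ) (hF : IsImmersionOn F U)
    (hx : x ∈ U) (v : E') (w : E) : G (F x) (normalPart G F x v) (fderiv ℝ F x w) = 0 := by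
  have h := congrArg (fun φ => φ w)
    ((hF.isRiemannianOn_pullback hG).apply_inverse hx ((G (F x) v).comp (fderiv ℝ F x)))
  simp only [pullbackMetric_apply] at h
  simp [normalPart, h]

theorem apply_normalPart_of_normal {N : E'} (hN : ∀ X : E, G (F x) (fderiv ℝ F x X) N = 0)
    (v : E') : G (F x) (normalPart G F x v) N = G (F x) v N := by
  simp [normalPart, hN]

/-- In the Koszul combination for the pull-back metric the second derivatives of F cancel, by
symmetry, except for the pairing of D²F(X,Y) with W; the remaining terms are the Koszul expression
of G. -/
theorem apply_covDerivAlong_fderiv (hG : IsRiemannianOn G Set.univ) (hF : IsImmersionOn F U)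
    (hx : x ∈ U) (X Y W : E) :
    G (F x) (covDerivAlong G F (fun y => fderiv ℝ F y Y) x X) (fderiv ℝ F x W) =
      christoffelForm (pullbackMetric G F) x X Y W := by
  have hg := (hF.isRiemannianOn_pullback hG).differentiableAt hx
  rw [christoffelForm_apply, covDerivAlong_fderiv hF hx, map_add, add_apply,
    hG.apply_christoffel (Set.mem_univ _), fderiv_pullbackMetric hG hF hx hg,
    fderiv_pullbackMetric hG hF hx hg, fderiv_pullbackMetric hG hF hx hg,
    hF.fderiv_fderiv_comm hx Y X, hF.fderiv_fderiv_comm hx W X, hF.fderiv_fderiv_comm hx W Y,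
    hG.symm _ (Set.mem_univ _) (fderiv ℝ (fderiv ℝ F) x X W)]
  ring

/-- The Gauss formula. -/
theorem gauss_formula (hG : IsRiemannianOn G Set.univ) (hF : IsImmersionOn F U)
    (hx : x ∈ U) (X Y : E) :
    covDerivAlong G F (fun y => fderiv ℝ F y Y) x X =
      fderiv ℝ F x (christoffel (pullbackMetric G F) x X Y) + secondFundamentalForm G F x X Y := by
  have h : (G (F x) (covDerivAlong G F (fun y => fderiv ℝ F y Y) x X)).comp (fderiv ℝ F x) =
      christoffelForm (pullbackMetric G F) x X Y := by
    ext W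
    exact apply_covDerivAlong_fderiv hG hF hx X Y W
  rw [secondFundamentalForm, normalPart, h, christoffel]
  simp

theorem secondFundamentalForm_normal (hG : IsRiemannianOn G Set.univ) (hF : IsImmersionOn F U)
    (hx : x ∈ U) (X Y W : E) :
    G (F x) (secondFundamentalForm G F x X Y) (fderiv ℝ F x W) = 0 :=
  apply_normalPart_fderiv hG hF hx _ _

theorem secondFundamentalForm_comm (hG : IsRiemannianOn G Set.univ) (hF : IsImmersionOn F U)
    (hx : x ∈ U) (X Y : E) :
    secondFundamentalForm G F x X Y = secondFundamentalForm G F x Y X := by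
  rw [secondFundamentalForm, secondFundamentalForm, covDerivAlong_fderiv hF hx,
    covDerivAlong_fderiv hF hx, hF.fderiv_fderiv_comm hx,
    hG.christoffel_comm (Set.mem_univ _)]

theorem contDiffOn_covDerivAlong (hG : IsRiemannianOn G Set.univ) (hF : IsImmersionOn F U)
    {V : E → E'} (hV : ContDiffOn ℝ ∞ V U) (Y : E) :
    ContDiffOn ℝ ∞ (fun y => covDerivAlong G F V y Y) U := by
  have hV' : ContDiffOn ℝ ∞ (fderiv ℝ V) U := hV.fderiv_of_isOpen hF.isOpen (by simp)
  refine (hV'.clm_apply contDiffOn_const).add ?_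
  exact ((hG.contDiffOn_christoffelL.comp hF.contDiffOn (Set.mapsTo_univ _ _)).clm_apply
    (hF.contDiffOn_fderiv.clm_apply contDiffOn_const)).clm_apply hV

/-- By the Gauss formula h is the ambient derivative minus the image of the intrinsic one, and both
are smooth. -/
theorem contDiffOn_secondFundamentalForm (hG : IsRiemannianOn G Set.univ)
    (hF : IsImmersionOn F U) (Y Z : E) :
    ContDiffOn ℝ ∞ (fun y => secondFundamentalForm G F y Y Z) U := by
  have h1 := contDiffOn_covDerivAlong hG hF
    (hF.contDiffOn_fderiv.clm_apply (contDiffOn_const (c := Z))) Y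
  have h2 := hF.contDiffOn_fderiv.clm_apply
    ((hF.isRiemannianOn_pullback hG).contDiffOn_christoffel Y Z)
  refine (h1.sub h2).congr fun y hy => ?_
  rw [gauss_formula hG hF hy]
  simp

theorem secondFundamentalForm_differentiableAt (hG : IsRiemannianOn G Set.univ)
    (hF : IsImmersionOn F U) (hx : x ∈ U) (Y Z : E) :
    DifferentiableAt ℝ (fun y => secondFundamentalForm G F y Y Z) x :=
  ((contDiffOn_secondFundamentalForm hG hF Y Z).contDiffAt
    (hF.isOpen.mem_nhds hx)).differentiableAt (by simp)

/-- The connection along `F` is metric. -/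
theorem fderiv_apply_covDerivAlong (hG : IsRiemannianOn G Set.univ) (hF : IsImmersionOn F U)
    (hx : x ∈ U) {V W : E → E'} (hV : DifferentiableAt ℝ V x) (hW : DifferentiableAt ℝ W x)
    (X : E) :
    fderiv ℝ (fun y => G (F y) (V y) (W y)) x X =
      G (F x) (covDerivAlong G F V x X) (W x) + G (F x) (V x) (covDerivAlong G F W x X) := by
  have h1 : HasFDerivAt (fun y => G (F y)) _ x :=
    (hG.differentiableAt (Set.mem_univ (F x))).hasFDerivAt.comp x (hF.hasFDerivAt hx)
  have h2 := (h1.clm_apply hV.hasFDerivAt).clm_apply hW.hasFDerivAt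
  rw [h2.fderiv]
  simp [covDerivAlong, hG.fderiv_eq (Set.mem_univ (F x))]
  ring

theorem covDerivAlong_add {V W : E → E'} (hV : DifferentiableAt ℝ V x)
    (hW : DifferentiableAt ℝ W x) (X : E) :
    covDerivAlong G F (fun y => V y + W y) x X =
      covDerivAlong G F V x X + covDerivAlong G F W x X := by
  have h := (hV.hasFDerivAt.add hW.hasFDerivAt).fderiv
  simp only [covDerivAlong, ← christoffelL_apply, map_add]
  erw [h]
  simp
  abel

theorem covDerivAlong_smul {φ : E → ℝ} {V : E → E'} (hφ : DifferentiableAt ℝ φ x)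
    (hV : DifferentiableAt ℝ V x) (X : E) :
    covDerivAlong G F (fun y => φ y • V y) x X =
      fderiv ℝ φ x X • V x + φ x • covDerivAlong G F V x X := by
  have h := (hφ.hasFDerivAt.smul hV.hasFDerivAt).fderiv
  simp only [covDerivAlong, ← christoffelL_apply, map_smul]
  erw [h]
  simp
  abel

/-- Leibniz rule for a tangent field with variable coefficients. It is needed because the tangential
part dF(∇_A Z) in the Gauss formula is not a constant coordinate field. -/
theorem covDerivAlong_fderiv_apply (hF : IsImmersionOn F U) (hx : x ∈ U) {γ : E → E}
    (hγ : DifferentiableAt ℝ γ x) (X : E) :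
    covDerivAlong G F (fun y => fderiv ℝ F y (γ y)) x X =
      covDerivAlong G F (fun y => fderiv ℝ F y (γ x)) x X + fderiv ℝ F x (fderiv ℝ γ x X) := by
  rw [covDerivAlong_fderiv hF hx, covDerivAlong,
    ((hF.hasFDerivAt_fderiv hx).clm_apply hγ.hasFDerivAt).fderiv]
  simp
  abel

/-- The curvature is the commutator of covariant derivatives along `F`. -/
theorem covDerivAlong_covDerivAlong_sub (hG : IsRiemannianOn G Set.univ) (hF : IsImmersionOn F U)
    (hx : x ∈ U) {V : E → E'} (hV : ContDiffOn ℝ ∞ V U) (X Y : E) :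
    covDerivAlong G F (fun y => covDerivAlong G F V y Y) x X
      - covDerivAlong G F (fun y => covDerivAlong G F V y X) x Y =
    curvature G (F x) (fderiv ℝ F x X) (fderiv ℝ F x Y) (V x) := by
  have hVx : ContDiffAt ℝ ∞ V x := hV.contDiffAt (hF.isOpen.mem_nhds hx)
  have hV1 : HasFDerivAt V (fderiv ℝ V x) x := (hVx.differentiableAt (by simp)).hasFDerivAt
  have hV2 : HasFDerivAt (fderiv ℝ V) (fderiv ℝ (fderiv ℝ V) x) x :=
    (((hV.fderiv_of_isOpen (m := ∞) hF.isOpen (by simp)).contDiffAt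
      (hF.isOpen.mem_nhds hx)).differentiableAt (by simp)).hasFDerivAt
  have hsymm : fderiv ℝ (fderiv ℝ V) x X Y = fderiv ℝ (fderiv ℝ V) x Y X :=
    hVx.isSymmSndFDerivAt (by simpa using ENat.LEInfty.out) X Y
  have hΓ : HasFDerivAt (fun y => christoffelL G (F y)) _ x :=
    (hG.hasFDerivAt_christoffelL (Set.mem_univ (F x))).comp x (hF.hasFDerivAt hx)
  -- Symmetric in A and B are the second derivatives of V and F and the pair of terms with dV; they
  -- cancel in the commutator. The derivative of the Christoffel symbols and their square make up
  -- the curvature.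
  have key : ∀ A B : E, covDerivAlong G F (fun y => covDerivAlong G F V y A) x B =
      fderiv ℝ (fderiv ℝ V) x B A
        + fderiv ℝ (christoffelL G) (F x) (fderiv ℝ F x B) (fderiv ℝ F x A) (V x)
        + christoffel G (F x) (fderiv ℝ (fderiv ℝ F) x B A) (V x)
        + christoffel G (F x) (fderiv ℝ F x A) (fderiv ℝ V x B)
        + christoffel G (F x) (fderiv ℝ F x B) (fderiv ℝ V x A)
        + christoffel G (F x) (fderiv ℝ F x B) (christoffel G (F x) (fderiv ℝ F x A) (V x)) := by
    intro A B
    have h1 : HasFDerivAt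
        (fun y => fderiv ℝ V y A + christoffelL G (F y) (fderiv ℝ F y A) (V y)) _ x :=
      (hV2.clm_apply (hasFDerivAt_const A x)).add
        ((hΓ.clm_apply (hF.hasFDerivAt_fderiv_apply hx A)).clm_apply hV1)
    rw [covDerivAlong]
    simp only [covDerivAlong, ← christoffelL_apply, map_add]
    rw [h1.fderiv]
    simp
    abel
  rw [key, key, hsymm, hF.fderiv_fderiv_comm hx X Y, hG.curvature_eq (Set.mem_univ _)]
  abel

end

end

end LocalRiemannian

/-! ### Gauss and Codazzi equations and their consequences -/

namespace LocalRiemannian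

noncomputable section

set_option maxSynthPendingDepth 3
set_option linter.unusedSectionVars false

variable {E E' : Type*} [NormedAddCommGroup E] [NormedSpace ℝ E]
  [NormedAddCommGroup E'] [NormedSpace ℝ E'] [FiniteDimensional ℝ E] [FiniteDimensional ℝ E']
  {G : E' → E' →L[ℝ] E' →L[ℝ] ℝ} {F : E → E'} {U : Set E} {x : E}

/-- The Gauss and Codazzi equations before the splitting in tangential and normal parts. -/
theorem curvature_along (hG : IsRiemannianOn G Set.univ) (hF : IsImmersionOn F U)
    (hx : x ∈ U) (X Y Z : E) :
    curvature G (F x) (fderiv ℝ F x X) (fderiv ℝ F x Y) (fderiv ℝ F x Z) =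
      fderiv ℝ F x (curvature (pullbackMetric G F) x X Y Z)
        + secondFundamentalForm G F x X (christoffel (pullbackMetric G F) x Y Z)
        - secondFundamentalForm G F x Y (christoffel (pullbackMetric G F) x X Z)
        + covDerivAlong G F (fun y => secondFundamentalForm G F y Y Z) x X
        - covDerivAlong G F (fun y => secondFundamentalForm G F y X Z) x Y := by
  have hg := hF.isRiemannianOn_pullback hG
  -- The Gauss formula for ∇_A Z is differentiated in direction B and applied once more to the
  -- tangential part.
  have key : ∀ A B : E,
      covDerivAlong G F (fun y => covDerivAlong G F (fun z => fderiv ℝ F z Z) y A) x B =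
        fderiv ℝ F x (christoffel (pullbackMetric G F) x B
          (christoffel (pullbackMetric G F) x A Z))
        + secondFundamentalForm G F x B (christoffel (pullbackMetric G F) x A Z)
        + fderiv ℝ F x (fderiv ℝ (fun y => christoffel (pullbackMetric G F) y A Z) x B)
        + covDerivAlong G F (fun y => secondFundamentalForm G F y A Z) x B := by
    intro A B
    have hγ : DifferentiableAt ℝ (fun y => christoffel (pullbackMetric G F) y A Z) x :=
      ((hg.contDiffOn_christoffel A Z).contDiffAt (hg.isOpen.mem_nhds hx)).differentiableAt
        (by simp)
    have h1 : (fun y => covDerivAlong G F (fun z => fderiv ℝ F z Z) y A) =ᶠ[nhds x]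
        fun y => fderiv ℝ F y (christoffel (pullbackMetric G F) y A Z)
          + secondFundamentalForm G F y A Z := by
      filter_upwards [hF.isOpen.mem_nhds hx] with y hy using gauss_formula hG hF hy A Z
    rw [covDerivAlong_congr h1, covDerivAlong_add
      ((hF.hasFDerivAt_fderiv hx).clm_apply hγ.hasFDerivAt).differentiableAt
      (secondFundamentalForm_differentiableAt hG hF hx A Z),
      covDerivAlong_fderiv_apply hF hx hγ, gauss_formula hG hF hx]
  rw [← covDerivAlong_covDerivAlong_sub hG hF hx
    (hF.contDiffOn_fderiv.clm_apply (contDiffOn_const (c := Z))), key, key, curvature]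
  simp only [map_add, map_sub]
  abel

/-- The Gauss equation. -/
theorem gauss_equation (hG : IsRiemannianOn G Set.univ) (hF : IsImmersionOn F U)
    (hx : x ∈ U) (X Y Z W : E) :
    G (F x) (curvature G (F x) (fderiv ℝ F x X) (fderiv ℝ F x Y) (fderiv ℝ F x Z))
        (fderiv ℝ F x W) =
      pullbackMetric G F x (curvature (pullbackMetric G F) x X Y Z) W
        - G (F x) (secondFundamentalForm G F x Y Z) (secondFundamentalForm G F x X W)
        + G (F x) (secondFundamentalForm G F x X Z) (secondFundamentalForm G F x Y W) := by
  -- Weingarten relation, from differentiating g(h(A,Z), dF W) = 0.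
  have key : ∀ A B : E,
      G (F x) (covDerivAlong G F (fun y => secondFundamentalForm G F y A Z) x B)
        (fderiv ℝ F x W) =
      - G (F x) (secondFundamentalForm G F x A Z) (secondFundamentalForm G F x B W) := by
    intro A B
    have h1 := fderiv_apply_covDerivAlong hG hF hx
      (secondFundamentalForm_differentiableAt hG hF hx A Z)
      (hF.hasFDerivAt_fderiv_apply hx W).differentiableAt B
    have h2 : (fun y => G (F y) (secondFundamentalForm G F y A Z) (fderiv ℝ F y W)) =ᶠ[nhds x]
        fun _ => 0 := by
      filter_upwards [hF.isOpen.mem_nhds hx] with y hy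
        using secondFundamentalForm_normal hG hF hy A Z W
    rw [h2.fderiv_eq, gauss_formula hG hF hx, map_add,
      secondFundamentalForm_normal hG hF hx A Z] at h1
    simp at h1
    linarith
  rw [curvature_along hG hF hx]
  simp only [map_add, map_sub, add_apply, sub_apply, key,
    secondFundamentalForm_normal hG hF hx, pullbackMetric_apply]
  ring

/-- The Codazzi equation. -/
theorem codazzi_equation (hG : IsRiemannianOn G Set.univ) (hF : IsImmersionOn F U)
    (hx : x ∈ U) {N : E'} (hN : ∀ X : E, G (F x) (fderiv ℝ F x X) N = 0) (X Y Z : E) :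
    G (F x) (curvature G (F x) (fderiv ℝ F x X) (fderiv ℝ F x Y) (fderiv ℝ F x Z)) N =
      G (F x) (derivSecondFundamentalForm G F x X Y Z) N
        - G (F x) (derivSecondFundamentalForm G F x Y X Z) N := by
  rw [curvature_along hG hF hx, derivSecondFundamentalForm, derivSecondFundamentalForm,
    (hF.isRiemannianOn_pullback hG).christoffel_comm hx Y X]
  simp only [map_add, map_sub, add_apply, sub_apply, hN, apply_normalPart_of_normal hN]
  ring

/-- The curvature tensor is natural under local isometries. -/
theorem curvature_of_isometry {G' : E' → E' →L[ℝ] E' →L[ℝ] ℝ} {φ : E' → E'} {V : Set E'} {p : E'}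
    (hG : IsRiemannianOn G Set.univ) (hφ : IsImmersionOn φ V) (hp : p ∈ V)
    (h : ∀ y ∈ V, pullbackMetric G φ y = G' y) (X Y Z W : E') :
    G (φ p) (curvature G (φ p) (fderiv ℝ φ p X) (fderiv ℝ φ p Y) (fderiv ℝ φ p Z))
        (fderiv ℝ φ p W) = G' p (curvature G' p X Y Z) W := by
  -- In equal dimensions there are no normal directions, so h = 0 and the Gauss equation becomes
  -- naturality of the curvature.
  have hs : Function.Surjective (fderiv ℝ φ p) :=
    LinearMap.injective_iff_surjective.1 (hφ.injective p hp)
  have h0 : ∀ A B, secondFundamentalForm G φ p A B = 0 := by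
    intro A B
    refine hG.ext (Set.mem_univ (φ p)) fun w => ?_
    obtain ⟨w, rfl⟩ := hs w
    rw [secondFundamentalForm_normal hG hφ hp]
    simp
  have h1 : pullbackMetric G φ =ᶠ[nhds p] G' := by
    filter_upwards [hφ.isOpen.mem_nhds hp] with y hy using h y hy
  have h2 : ∀ A B, (fun y => christoffel (pullbackMetric G φ) y A B) =ᶠ[nhds p]
      fun y => christoffel G' y A B := by
    intro A B
    filter_upwards [h1.eventuallyEq_nhds] with y hy
    simp only [christoffel, christoffelForm, hy.fderiv_eq, hy.eq_of_nhds]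
  have h3 : curvature (pullbackMetric G φ) p X Y Z = curvature G' p X Y Z := by
    simp only [curvature, (h2 _ _).fderiv_eq, (h2 _ _).eq_of_nhds]
  rw [gauss_equation hG hφ hp, h3, h p hp]
  simp [h0]

/-- A Codazzi hypersurface has no curvature components of the form `R(X, Y, Z, N)`. -/
theorem apply_curvature_normal_of_codazzi (hG : IsRiemannianOn G Set.univ)
    (hF : IsImmersionOn F U) (hx : x ∈ U) (hC : IsCodazziAt G F x) {N : E'}
    (hN : ∀ X : E, G (F x) (fderiv ℝ F x X) N = 0) (X Y Z : E) :
    G (F x) (curvature G (F x) (fderiv ℝ F x X) (fderiv ℝ F x Y) (fderiv ℝ F x Z)) N = 0 := by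
  rw [codazzi_equation hG hF hx hN, (hC X Y Z).1, sub_self]

/-- A unit normal vector exists at each point of a hypersurface. -/
theorem exists_isUnitNormal (hG : IsRiemannianOn G Set.univ)
    (hd : Module.finrank ℝ E < Module.finrank ℝ E') (F : E → E') (x : E) :
    ∃ N, IsUnitNormal G F x N := by
  let L : E' →ₗ[ℝ] Module.Dual ℝ E :=
    { toFun := fun n => (G (F x) n).toLinearMap ∘ₗ (fderiv ℝ F x).toLinearMap
      map_add' := fun m n => by ext; simp
      map_smul' := fun c n => by ext; simp }
  have hL : L.ker ≠ ⊥ := by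
    apply LinearMap.ker_ne_bot_of_finrank_lt
    rwa [Subspace.dual_finrank_eq]
  obtain ⟨n, hn, hn0⟩ := Submodule.exists_mem_ne_zero_of_ne_bot hL
  have hpos := hG.pos (F x) (Set.mem_univ _) n hn0
  refine ⟨(Real.sqrt (G (F x) n n))⁻¹ • n, ?_, fun X => ?_⟩
  · have : Real.sqrt (G (F x) n n) ≠ 0 := (Real.sqrt_pos.2 hpos).ne'
    simp only [map_smul, smul_apply, smul_eq_mul]
    field_simp
    rw [Real.sq_sqrt hpos.le]
  · have h1 : L n X = 0 := by rw [LinearMap.mem_ker.1 hn]; rfl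
    have h2 : G (F x) n (fderiv ℝ F x X) = 0 := h1
    rw [map_smul, hG.symm _ (Set.mem_univ _) (fderiv ℝ F x X), h2, smul_zero]

/-- Along a hypersurface, vectors normal to the hypersurface and to a unit normal vanish. -/
theorem eq_zero_of_normal (hG : IsRiemannianOn G Set.univ) (hF : IsImmersionOn F U) (hx : x ∈ U)
    (hd : Module.finrank ℝ E' = Module.finrank ℝ E + 1) {N v : E'} (hN : IsUnitNormal G F x N)
    (hv : ∀ X : E, G (F x) v (fderiv ℝ F x X) = 0) (hvN : G (F x) v N = 0) : v = 0 := by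
  have hNr : N ∉ LinearMap.range (fderiv ℝ F x).toLinearMap := by
    rintro ⟨X, rfl⟩
    have h1 := hN.1
    have h2 := hN.2 X
    simp only [ContinuousLinearMap.coe_coe] at h1 h2
    linarith
  have hle : LinearMap.range (fderiv ℝ F x).toLinearMap <
      LinearMap.range (fderiv ℝ F x).toLinearMap ⊔ Submodule.span ℝ {N} := by
    refine lt_of_le_of_ne le_sup_left fun h => hNr ?_
    rw [h]
    exact Submodule.mem_sup_right (Submodule.mem_span_singleton_self N)
  have hrank := Submodule.finrank_lt_finrank_of_lt hle
  rw [LinearMap.finrank_range_of_inj (hF.injective x hx)] at hrank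
  have htop : LinearMap.range (fderiv ℝ F x).toLinearMap ⊔ Submodule.span ℝ {N} = ⊤ :=
    Submodule.eq_top_of_finrank_eq (le_antisymm (Submodule.finrank_le _) (by omega))
  refine hG.ext (Set.mem_univ (F x)) fun w => ?_
  have hw : w ∈ LinearMap.range (fderiv ℝ F x).toLinearMap ⊔ Submodule.span ℝ {N} := by
    rw [htop]; trivial
  obtain ⟨_, ⟨X, rfl⟩, _, hn, rfl⟩ := Submodule.mem_sup.1 hw
  obtain ⟨c, rfl⟩ := Submodule.mem_span_singleton.1 hn
  simp [hv, hvN]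

/-- A totally umbilical hypersurface has no curvature components of the form `R(X, Y, Z, N)` with
`Z` orthogonal to `X` and `Y`. -/
theorem apply_curvature_normal_of_umbilical (hG : IsRiemannianOn G Set.univ)
    (hF : IsImmersionOn F U) (hx : x ∈ U)
    (hd : Module.finrank ℝ E' = Module.finrank ℝ E + 1)
    (hU : ∀ y ∈ U, IsTotallyUmbilicalAt G F y) {N : E'}
    (hN : ∀ X : E, G (F x) (fderiv ℝ F x X) N = 0) {X Y Z : E}
    (hXZ : pullbackMetric G F x X Z = 0) (hYZ : pullbackMetric G F x Y Z = 0) :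
    G (F x) (curvature G (F x) (fderiv ℝ F x X) (fderiv ℝ F x Y) (fderiv ℝ F x Z)) N = 0 := by
  have hg := hF.isRiemannianOn_pullback hG
  -- The case Z = 0 is separate because g(Z,Z) becomes a denominator: H is taken to be h(Z,Z) /
  -- g(Z,Z).
  rcases eq_or_ne Z 0 with rfl | hZ
  · have h1 : ∀ A : E', christoffel G (F x) A 0 = 0 := fun A => by
      rw [← christoffelL_apply, map_zero]
    rw [map_zero, hG.curvature_eq (Set.mem_univ _)]
    simp [h1]
  -- `h = g ⊗ H` with a smooth mean curvature vector field `H`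
  let φ : E → E → E → ℝ := fun A B y => pullbackMetric G F y A B * (pullbackMetric G F y Z Z)⁻¹
  have hh : ∀ y ∈ U, ∀ A B : E, secondFundamentalForm G F y A B =
      φ A B y • secondFundamentalForm G F y Z Z := by
    intro y hy A B
    obtain ⟨n, hn⟩ := exists_isUnitNormal hG (by omega) F y
    obtain ⟨μ, hμ⟩ := hU y hy n hn
    have hpos := (hg.pos y hy Z hZ).ne'
    rw [← sub_eq_zero]
    refine eq_zero_of_normal hG hF hy hd hn (fun W => ?_) ?_
    · simp [secondFundamentalForm_normal hG hF hy]
    · rw [map_sub, map_smul, sub_apply, smul_apply, hμ, hμ, smul_eq_mul]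
      simp only [φ]
      field_simp
      ring
  have hdg : ∀ A B, DifferentiableAt ℝ (fun y => pullbackMetric G F y A B) x := fun A B =>
    ((((hg.differentiableAt hx).hasFDerivAt.clm_apply (hasFDerivAt_const A x))).clm_apply
      (hasFDerivAt_const B x)).differentiableAt
  have hpos := (hg.pos x hx Z hZ).ne'
  have hi : DifferentiableAt ℝ (fun y => (pullbackMetric G F y Z Z)⁻¹) x := (hdg Z Z).inv hpos
  have hφ : ∀ A B, DifferentiableAt ℝ (φ A B) x := fun A B => (hdg A B).mul hi
  -- Since g(A,Z) = 0 at x, the coefficient of h(Z,Z) vanishes there. Only its derivative survives,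
  -- so no derivative of H appears; ∇g = 0 expresses the rest through Christoffel symbols, which
  -- cancel against the h(·, ∇Z) terms and by symmetry.
  have hcov : ∀ A B, pullbackMetric G F x A Z = 0 →
      covDerivAlong G F (fun y => secondFundamentalForm G F y A Z) x B =
        ((pullbackMetric G F x (christoffel (pullbackMetric G F) x B A) Z
          + pullbackMetric G F x A (christoffel (pullbackMetric G F) x B Z))
          * (pullbackMetric G F x Z Z)⁻¹) • secondFundamentalForm G F x Z Z := by
    intro A B hA
    have h1 : (fun y => secondFundamentalForm G F y A Z) =ᶠ[nhds x]
        fun y => φ A Z y • secondFundamentalForm G F y Z Z := by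
      filter_upwards [hF.isOpen.mem_nhds hx] with y hy using hh y hy A Z
    have h2 : fderiv ℝ (φ A Z) x B =
        fderiv ℝ (pullbackMetric G F) x B A Z * (pullbackMetric G F x Z Z)⁻¹ := by
      have h3 := ((hdg A Z).hasFDerivAt.mul hi.hasFDerivAt).fderiv
      change fderiv ℝ (fun y => pullbackMetric G F y A Z * (pullbackMetric G F y Z Z)⁻¹) x B = _
      erw [h3]
      rw [← fderiv_apply_apply (hg.differentiableAt hx), hA]
      simp [mul_comm]
    rw [covDerivAlong_congr h1, covDerivAlong_smul (hφ A Z)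
      (secondFundamentalForm_differentiableAt hG hF hx Z Z), h2, hg.fderiv_eq hx]
    have : φ A Z x = 0 := by simp only [φ]; rw [hA, zero_mul]
    rw [this, zero_smul, add_zero]
  rw [curvature_along hG hF hx, hcov Y X hYZ, hcov X Y hXZ, hh x hx X, hh x hx Y,
    hg.christoffel_comm hx Y X]
  simp only [φ, map_add, map_sub, map_smul, add_apply, sub_apply, smul_apply, hN, smul_eq_mul]
  ring

end

end LocalRiemannian

namespace CP3

noncomputable section

set_option maxSynthPendingDepth 3

/-! ## The metric in homogeneous coordinates -/

theorem jMul_add (x y : EuclideanSpace ℂ (Fin 4)) : jMul (x + y) = jMul x + jMul y := by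
  ext k
  fin_cases k <;> simp [jMul] <;> ring

theorem jMul_smul (c : ℂ) (x : EuclideanSpace ℂ (Fin 4)) : jMul (c • x) = star c • jMul x := by
  ext k
  fin_cases k <;> simp [jMul]

theorem jMul_jMul (x : EuclideanSpace ℂ (Fin 4)) : jMul (jMul x) = -x := by
  ext k
  fin_cases k <;> simp [jMul]

/-- The complex symplectic form of `ℂ⁴ = ℍ²`; its contraction with the position vector defines the
holomorphic contact distribution `𝓓₂`. -/
def symplecticForm (z u : EuclideanSpace ℂ (Fin 4)) : ℂ :=
  z 0 * u 1 - z 1 * u 0 + z 2 * u 3 - z 3 * u 2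

theorem inner_jMul_left (z u : EuclideanSpace ℂ (Fin 4)) :
    inner ℂ (jMul z) u = symplecticForm z u := by
  simp [PiLp.inner_apply, Fin.sum_univ_four, jMul, symplecticForm]
  ring

theorem inner_jMul_right (z u : EuclideanSpace ℂ (Fin 4)) :
    inner ℂ u (jMul z) = star (symplecticForm z u) := by
  rw [← inner_conj_symm, inner_jMul_left]
  rfl

theorem inner_jMul_jMul (z u : EuclideanSpace ℂ (Fin 4)) :
    inner ℂ (jMul z) (jMul u) = star (inner ℂ z u) := by
  simp [PiLp.inner_apply, Fin.sum_univ_four, jMul]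
  ring

theorem symplecticForm_self (z : EuclideanSpace ℂ (Fin 4)) : symplecticForm z z = 0 := by
  simp only [symplecticForm]
  ring

theorem symplecticForm_swap (z u : EuclideanSpace ℂ (Fin 4)) :
    symplecticForm z u = -symplecticForm u z := by
  simp only [symplecticForm]
  ring

theorem symplecticForm_add_left (x y u : EuclideanSpace ℂ (Fin 4)) :
    symplecticForm (x + y) u = symplecticForm x u + symplecticForm y u := by
  simp only [symplecticForm, PiLp.add_apply]
  ring

theorem symplecticForm_add_right (x y u : EuclideanSpace ℂ (Fin 4)) :
    symplecticForm u (x + y) = symplecticForm u x + symplecticForm u y := by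
  simp only [symplecticForm, PiLp.add_apply]
  ring

theorem symplecticForm_smul_left (c : ℂ) (z u : EuclideanSpace ℂ (Fin 4)) :
    symplecticForm (c • z) u = c * symplecticForm z u := by
  simp only [symplecticForm, PiLp.smul_apply, smul_eq_mul]
  ring

theorem symplecticForm_smul_right (c : ℂ) (z u : EuclideanSpace ℂ (Fin 4)) :
    symplecticForm z (c • u) = c * symplecticForm z u := by
  simp only [symplecticForm, PiLp.smul_apply, smul_eq_mul]
  ring

/-- The pull-back of `g_a` to `ℂ⁴ ∖ {0}`. -/
def homMetric (a : ℝ) (z u v : EuclideanSpace ℂ (Fin 4)) : ℝ :=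
  (a * (inner ℂ u v * (‖z‖ : ℂ) ^ 2 - inner ℂ u z * inner ℂ z v).re
    + (1 - a) * (star (symplecticForm z u) * symplecticForm z v).re) / (‖z‖ ^ 2) ^ 2

theorem real_inner_eq_re (x y : EuclideanSpace ℂ (Fin 4)) : inner ℝ x y = (inner ℂ x y).re := by
  simp [PiLp.inner_apply, Complex.inner]

theorem inner_horizontalLift_horizontalLift (i : Fin 4) (w u v : Fin 3 → ℂ) :
    inner ℂ (horizontalLift i w u) (horizontalLift i w v) =
      (inner ℂ (homDir i u) (homDir i v) * (‖homCoord i w‖ : ℂ) ^ 2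
        - inner ℂ (homDir i u) (homCoord i w) * inner ℂ (homCoord i w) (homDir i v))
          / (‖homCoord i w‖ ^ 2) ^ 2 := by
  have hn := norm_ne_zero_iff.2 (homCoord_ne_zero i w)
  have hzz : inner ℂ (homCoord i w) (homCoord i w) = (‖homCoord i w‖ : ℂ) ^ 2 :=
    inner_self_eq_norm_sq_to_K _
  rw [horizontalLift_apply, horizontalLift_apply, spherePoint]
  generalize homDir i u = U
  generalize homDir i v = V
  generalize homCoord i w = z at *
  have hc : (‖z‖ : ℂ) ≠ 0 := by exact_mod_cast hn
  simp only [inner_smul_left, inner_smul_right, inner_sub_left, inner_sub_right, hzz,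
    map_mul, map_inv₀, Complex.conj_ofReal, inner_conj_symm]
  field_simp
  ring

theorem inner_jMul_spherePoint_horizontalLift (i : Fin 4) (w u : Fin 3 → ℂ) :
    inner ℂ (jMul (spherePoint i w)) (horizontalLift i w u) =
      symplecticForm (homCoord i w) (homDir i u) / ‖homCoord i w‖ ^ 2 := by
  have hn := norm_ne_zero_iff.2 (homCoord_ne_zero i w)
  rw [horizontalLift_apply, spherePoint]
  generalize homDir i u = U
  generalize homCoord i w = z at *
  have hc : (‖z‖ : ℂ) ≠ 0 := by exact_mod_cast hn
  simp only [jMul_smul, inner_smul_left, inner_smul_right, inner_sub_right, inner_jMul_left,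
    symplecticForm_self, map_inv₀, Complex.conj_ofReal, Complex.star_def]
  field_simp
  ring

theorem inner_almostProduct_left (p x y : EuclideanSpace ℂ (Fin 4)) :
    inner ℂ (almostProduct p x) y =
      inner ℂ x y - 2 * (star (inner ℂ (jMul p) x) * inner ℂ (jMul p) y) := by
  rw [almostProduct, lineProj, sub_apply, inner_sub_left, smul_apply, inner_smul_left,
    ContinuousLinearMap.smulRight_apply, inner_smul_left, innerSL_apply_apply,
    ContinuousLinearMap.id_apply, Complex.star_def]
  simp only [map_ofNat]

/-- On horizontal vectors g₁(PX,Y) = g₁(X,Y) - 2 Re(θ̄(X) θ(Y)), so the two summands of g_a combine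
to a g₁ + (1 - a) Re(θ̄ θ). This removes the sphere point and leaves an expression that is rational
in the real coordinates. -/
theorem metric_eq_homMetric (a : ℝ) (i : Fin 4) (w u v : Fin 3 → ℂ) :
    metric a i w u v = homMetric a (homCoord i w) (homDir i u) (homDir i v) := by
  rw [metric_apply, real_inner_eq_re, real_inner_eq_re, inner_almostProduct_left,
    inner_jMul_spherePoint_horizontalLift, inner_jMul_spherePoint_horizontalLift,
    inner_horizontalLift_horizontalLift, homMetric]
  have h1 : ∀ (X : ℂ) (n : ℝ), (X / ((n : ℂ) ^ 2) ^ 2).re = X.re / (n ^ 2) ^ 2 := by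
    intro X n
    rw [← Complex.ofReal_pow, ← Complex.ofReal_pow, Complex.div_ofReal_re]
  have h2 : ∀ (X Y : ℂ) (n : ℝ), star (X / (n : ℂ) ^ 2) * (Y / (n : ℂ) ^ 2) =
      (star X * Y) / ((n : ℂ) ^ 2) ^ 2 := by
    intro X Y n
    simp only [Complex.star_def, map_div₀, map_pow, Complex.conj_ofReal]
    rw [div_mul_div_comm]
    ring
  have h3 : ∀ X : ℂ, (2 * X).re = 2 * X.re := fun X => by simp
  rw [h2, Complex.sub_re, h3, h1, h1]
  ring

/-- The form descends to projective space: rescaling z and the vectors by c gives |c|⁴ in numerator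
and denominator, and multiples of z are killed by the horizontal projection and by σ(z,z) = 0. -/
theorem homMetric_smul (a : ℝ) {c : ℂ} (hc : c ≠ 0) (μ ν : ℂ) (z u v : EuclideanSpace ℂ (Fin 4)) :
    homMetric a (c • z) (c • u + μ • z) (c • v + ν • z) = homMetric a z u v := by
  have hzz : inner ℂ z z = (‖z‖ : ℂ) ^ 2 := inner_self_eq_norm_sq_to_K _
  have hcc : (starRingEnd ℂ) c * c = ((‖c‖ ^ 2 : ℝ) : ℂ) := by
    rw [Complex.conj_mul']
    simp
  have hn : ‖c‖ ≠ 0 := norm_ne_zero_iff.2 hc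
  have h1 : inner ℂ (c • u + μ • z) (c • v + ν • z) * (‖c • z‖ : ℂ) ^ 2
      - inner ℂ (c • u + μ • z) (c • z) * inner ℂ (c • z) (c • v + ν • z) =
      ((‖c‖ ^ 4 : ℝ) : ℂ) * (inner ℂ u v * (‖z‖ : ℂ) ^ 2 - inner ℂ u z * inner ℂ z v) := by
    have h2 : ((‖c‖ ^ 4 : ℝ) : ℂ) = ((starRingEnd ℂ) c * c) ^ 2 := by
      rw [hcc]; push_cast; ring
    have h3 : (‖c • z‖ : ℂ) ^ 2 = (starRingEnd ℂ) c * c * (‖z‖ : ℂ) ^ 2 := by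
      rw [hcc, norm_smul]; push_cast; ring
    rw [h2, h3]
    simp only [inner_add_left, inner_add_right, inner_smul_left, inner_smul_right, hzz]
    ring
  have h4 : star (symplecticForm (c • z) (c • u + μ • z)) *
      symplecticForm (c • z) (c • v + ν • z) =
      ((‖c‖ ^ 4 : ℝ) : ℂ) * (star (symplecticForm z u) * symplecticForm z v) := by
    have h2 : ((‖c‖ ^ 4 : ℝ) : ℂ) = ((starRingEnd ℂ) c * c) ^ 2 := by
      rw [hcc]; push_cast; ring
    rw [h2]
    simp only [symplecticForm_smul_left, symplecticForm_add_right, symplecticForm_smul_right,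
      symplecticForm_self, Complex.star_def, map_mul, mul_zero, add_zero]
    ring
  rw [homMetric, h1, h4, Complex.re_ofReal_mul, Complex.re_ofReal_mul, norm_smul, homMetric]
  rcases eq_or_ne z 0 with rfl | hz
  · simp
  have hz' : ‖z‖ ≠ 0 := norm_ne_zero_iff.2 hz
  field_simp

/-- Left-`ℍ`-linear isometries of `ℂ⁴ = ℍ²`. -/
structure IsSymplecticIsometry
    (A : EuclideanSpace ℂ (Fin 4) →L[ℂ] EuclideanSpace ℂ (Fin 4)) : Prop where
  inner_map : ∀ x y, inner ℂ (A x) (A y) = inner ℂ x y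
  map_jMul : ∀ x, A (jMul x) = jMul (A x)

section

variable {A : EuclideanSpace ℂ (Fin 4) →L[ℂ] EuclideanSpace ℂ (Fin 4)}

theorem IsSymplecticIsometry.symplecticForm_map (hA : IsSymplecticIsometry A)
    (x y : EuclideanSpace ℂ (Fin 4)) :
    symplecticForm (A x) (A y) = symplecticForm x y := by
  rw [← inner_jMul_left, ← hA.map_jMul, hA.inner_map, inner_jMul_left]

theorem IsSymplecticIsometry.norm_map (hA : IsSymplecticIsometry A)
    (x : EuclideanSpace ℂ (Fin 4)) : ‖A x‖ = ‖x‖ := by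
  have h := hA.inner_map x x
  rw [inner_self_eq_norm_sq_to_K, inner_self_eq_norm_sq_to_K] at h
  have h' : ‖A x‖ ^ 2 = ‖x‖ ^ 2 := by exact_mod_cast h
  exact (sq_eq_sq₀ (norm_nonneg _) (norm_nonneg _)).1 h'

theorem IsSymplecticIsometry.homMetric_map (hA : IsSymplecticIsometry A) (a : ℝ)
    (z u v : EuclideanSpace ℂ (Fin 4)) : homMetric a (A z) (A u) (A v) = homMetric a z u v := by
  simp only [homMetric, hA.inner_map, hA.symplecticForm_map, hA.norm_map]

end

theorem homCoord_eq_add (i : Fin 4) (w : Fin 3 → ℂ) :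
    homCoord i w = homCoord i 0 + homDir i w := by
  ext k
  rcases Fin.eq_self_or_eq_succAbove i k with rfl | ⟨l, rfl⟩ <;> simp

theorem hasFDerivAt_homCoord (i : Fin 4) (w : Fin 3 → ℂ) :
    HasFDerivAt (homCoord i) ((homDir i).restrictScalars ℝ) w := by
  have h : homCoord i = fun w => homCoord i 0 + (homDir i).restrictScalars ℝ w := by
    funext w
    exact homCoord_eq_add i w
  rw [h]
  exact ((homDir i).restrictScalars ℝ).hasFDerivAt.const_add _

theorem contDiff_homCoord (i : Fin 4) : ContDiff ℝ ∞ (homCoord i) := by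
  have h : homCoord i = fun w => homCoord i 0 + (homDir i).restrictScalars ℝ w := by
    funext w
    exact homCoord_eq_add i w
  rw [h]
  exact contDiff_const.add ((homDir i).restrictScalars ℝ).contDiff

theorem homCoord_affineCoord (i : Fin 4) {z : EuclideanSpace ℂ (Fin 4)} (hz : z i ≠ 0) :
    homCoord i (affineCoord i z) = (z i)⁻¹ • z := by
  ext k
  rcases Fin.eq_self_or_eq_succAbove i k with rfl | ⟨l, rfl⟩
  · simp [hz]
  · simp [affineCoord, div_eq_inv_mul]

/-- `g_a` is a Riemannian metric in each affine chart. -/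
theorem isRiemannianOn_metric (a : ℝ) (ha : 0 < a) (i : Fin 4) :
    LocalRiemannian.IsRiemannianOn (metric a i) Set.univ where
  isOpen := isOpen_univ
  symm w _ u v := metric_comm a i w u v
  pos w _ u hu := metric_pos a ha i w u hu
  contDiffOn := by
    rw [contDiffOn_clm_apply]
    intro u
    rw [contDiffOn_clm_apply]
    intro v
    rw [contDiffOn_univ]
    simp only [metric_eq_homMetric, homMetric]
    have hz := contDiff_homCoord i
    have hk : ∀ k, ContDiff ℝ ∞ fun w => homCoord i w k := fun k =>
      ((EuclideanSpace.proj (𝕜 := ℂ) k).restrictScalars ℝ).contDiff.comp hz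
    have hS : ∀ u, ContDiff ℝ ∞ fun w => symplecticForm (homCoord i w) (homDir i u) := by
      intro u
      simp only [symplecticForm]
      have h0 := hk 0
      have h1 := hk 1
      have h2 := hk 2
      have h3 := hk 3
      fun_prop
    have hn : ContDiff ℝ ∞ fun w => ‖homCoord i w‖ ^ 2 := hz.norm_sq ℂ
    have hn' : ContDiff ℝ ∞ fun w => (‖homCoord i w‖ : ℂ) ^ 2 := by
      simp only [← Complex.ofReal_pow]
      exact Complex.ofRealCLM.contDiff.comp hn
    have hre : ∀ {f : (Fin 3 → ℂ) → ℂ}, ContDiff ℝ ∞ f → ContDiff ℝ ∞ fun w => (f w).re :=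
      fun hf => Complex.reCLM.contDiff.comp hf
    refine ContDiff.div ?_ (hn.pow 2) fun w => ?_
    · refine (contDiff_const.mul (hre ?_)).add (contDiff_const.mul (hre ?_))
      · exact (contDiff_const.mul hn').sub
          ((contDiff_const.inner ℂ hz).mul (hz.inner ℂ contDiff_const))
      · exact (Complex.conjCLE.contDiff.comp (hS u)).mul (hS v)
    · have := norm_ne_zero_iff.2 (homCoord_ne_zero i w)
      positivity

end

end CP3

/-! ### Isometries of the projective space and the normal form of a tangent vector -/

namespace CP3

noncomputable section

set_option maxSynthPendingDepth 3

open LocalRiemannian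

/-- The map of `CP3` induced by a linear map, from the affine chart `0` to the affine chart `i`. -/
def affineMap (i : Fin 4) (A : EuclideanSpace ℂ (Fin 4) →L[ℂ] EuclideanSpace ℂ (Fin 4))
    (w : Fin 3 → ℂ) : Fin 3 → ℂ :=
  affineCoord i (A (homCoord 0 w))

section

variable {A : EuclideanSpace ℂ (Fin 4) →L[ℂ] EuclideanSpace ℂ (Fin 4)} {i : Fin 4} {w : Fin 3 → ℂ}

theorem contDiff_map_homCoord (i : Fin 4)
    (A : EuclideanSpace ℂ (Fin 4) →L[ℂ] EuclideanSpace ℂ (Fin 4)) (k : Fin 4) :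
    ContDiff ℝ ∞ fun w => A (homCoord i w) k :=
  ((EuclideanSpace.proj (𝕜 := ℂ) k).restrictScalars ℝ).contDiff.comp
    ((A.restrictScalars ℝ).contDiff.comp (contDiff_homCoord i))

theorem contDiffOn_affineMap (i : Fin 4)
    (A : EuclideanSpace ℂ (Fin 4) →L[ℂ] EuclideanSpace ℂ (Fin 4)) :
    ContDiffOn ℝ ∞ (affineMap i A) {w | A (homCoord 0 w) i ≠ 0} := by
  rw [contDiffOn_pi]
  intro k
  simp only [affineMap, affineCoord, div_eq_mul_inv]
  exact (contDiff_map_homCoord 0 A _).contDiffOn.mul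
    ((contDiff_map_homCoord 0 A i).contDiffOn.inv fun w hw => hw)

theorem isOpen_affineMap_domain (i : Fin 4)
    (A : EuclideanSpace ℂ (Fin 4) →L[ℂ] EuclideanSpace ℂ (Fin 4)) :
    IsOpen {w | A (homCoord 0 w) i ≠ 0} :=
  isOpen_ne_fun (contDiff_map_homCoord 0 A i).continuous continuous_const

/-- The lift of `affineMap i A` is Az divided by its i-th coordinate. The derivative of the scalar
factor contributes a multiple of Az, whose value is irrelevant by `homMetric_smul`. -/
theorem exists_homDir_fderiv_affineMap (hw : A (homCoord 0 w) i ≠ 0) (u : Fin 3 → ℂ) :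
    ∃ μ : ℂ, homDir i (fderiv ℝ (affineMap i A) w u) =
      (A (homCoord 0 w) i)⁻¹ • A (homDir 0 u) + μ • A (homCoord 0 w) := by
  have hV := isOpen_affineMap_domain i A
  have h1 : HasFDerivAt (affineMap i A) (fderiv ℝ (affineMap i A) w) w :=
    (((contDiffOn_affineMap i A).contDiffAt (hV.mem_nhds hw)).differentiableAt
      (by simp)).hasFDerivAt
  have h2 := (hasFDerivAt_homCoord i (affineMap i A w)).comp w h1
  have h3 : HasFDerivAt (fun y => A (homCoord 0 y)) _ w :=
    (A.restrictScalars ℝ).hasFDerivAt.comp w (hasFDerivAt_homCoord 0 w)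
  have h4 : DifferentiableAt ℝ (fun y => (A (homCoord 0 y) i)⁻¹) w :=
    ((contDiff_map_homCoord 0 A i).differentiable (by simp) w).inv hw
  have h5 := h4.hasFDerivAt.smul h3
  have h6 : (homCoord i ∘ affineMap i A) =ᶠ[nhds w]
      (fun y => (A (homCoord 0 y) i)⁻¹) • fun y => A (homCoord 0 y) := by
    filter_upwards [hV.mem_nhds hw] with y hy using homCoord_affineCoord i hy
  have h7 := congrArg (fun L => L u) (h2.unique (h5.congr_of_eventuallyEq h6))
  refine ⟨fderiv ℝ (fun y => (A (homCoord 0 y) i)⁻¹) w u, ?_⟩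
  simpa using h7

theorem IsSymplecticIsometry.pullbackMetric_affineMap (hA : IsSymplecticIsometry A) (a : ℝ)
    (hw : A (homCoord 0 w) i ≠ 0) :
    pullbackMetric (metric a i) (affineMap i A) w = metric a 0 w := by
  ext u v
  obtain ⟨μ, hμ⟩ := exists_homDir_fderiv_affineMap hw u
  obtain ⟨ν, hν⟩ := exists_homDir_fderiv_affineMap hw v
  rw [pullbackMetric_apply, metric_eq_homMetric, hμ, hν, affineMap, homCoord_affineCoord i hw,
    homMetric_smul a (inv_ne_zero hw), hA.homMetric_map, metric_eq_homMetric]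

theorem IsSymplecticIsometry.isImmersionOn_affineMap (hA : IsSymplecticIsometry A) (i : Fin 4) :
    IsImmersionOn (affineMap i A) {w | A (homCoord 0 w) i ≠ 0} where
  isOpen := isOpen_affineMap_domain i A
  contDiffOn := contDiffOn_affineMap i A
  injective w hw := by
    rw [injective_iff_map_eq_zero]
    intro u hu
    by_contra hne
    -- A kernel vector would have length zero in the pulled-back metric; any positive parameter
    -- would serve, and 1 is taken.
    have h1 := metric_pos 1 one_pos 0 w u hne
    rw [← hA.pullbackMetric_affineMap 1 hw, pullbackMetric_apply, hu] at h1
    simp at h1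

end

/-- The linear map with columns `p`, `jp`, `q`, `jq`. -/
def frameMap (p q : EuclideanSpace ℂ (Fin 4)) :
    EuclideanSpace ℂ (Fin 4) →L[ℂ] EuclideanSpace ℂ (Fin 4) :=
  (EuclideanSpace.proj (𝕜 := ℂ) (0 : Fin 4)).smulRight p +
  (EuclideanSpace.proj (𝕜 := ℂ) (1 : Fin 4)).smulRight (jMul p) +
  (EuclideanSpace.proj (𝕜 := ℂ) (2 : Fin 4)).smulRight q +
  (EuclideanSpace.proj (𝕜 := ℂ) (3 : Fin 4)).smulRight (jMul q)

theorem frameMap_apply (p q x : EuclideanSpace ℂ (Fin 4)) :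
    frameMap p q x = x 0 • p + x 1 • jMul p + x 2 • q + x 3 • jMul q := by
  simp [frameMap]

/-- Since σ(p,q) = ⟨jp,q⟩, the two orthogonality conditions make p, jp, q, jq a unitary basis, and j
acts on it as on the standard basis. -/
theorem isSymplecticIsometry_frameMap {p q : EuclideanSpace ℂ (Fin 4)} (hp : ‖p‖ = 1)
    (hq : ‖q‖ = 1) (hpq : inner ℂ p q = 0) (hjpq : symplecticForm p q = 0) :
    IsSymplecticIsometry (frameMap p q) where
  inner_map x y := by
    have hpp : inner ℂ p p = 1 := by rw [inner_self_eq_norm_sq_to_K, hp]; simp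
    have hqq : inner ℂ q q = 1 := by rw [inner_self_eq_norm_sq_to_K, hq]; simp
    have hqp : inner ℂ q p = 0 := by rw [← inner_conj_symm, hpq, map_zero]
    have hjqp : symplecticForm q p = 0 := by rw [symplecticForm_swap, hjpq, neg_zero]
    simp only [frameMap_apply, inner_add_left, inner_add_right, inner_smul_left, inner_smul_right,
      inner_jMul_jMul]
    simp only [inner_jMul_left, inner_jMul_right, symplecticForm_self, hpp, hqq, hpq, hqp,
      hjpq, hjqp]
    simp [PiLp.inner_apply, Fin.sum_univ_four]
  map_jMul x := by
    simp only [frameMap_apply, jMul_add, jMul_smul, jMul_jMul]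
    simp [jMul]
    abel

/-- Two complex linear equations on ℂ⁴ have a nonzero solution. It completes the frame when N has no
𝓓₂-component to single out a direction. -/
theorem exists_unit_orthogonal (p : EuclideanSpace ℂ (Fin 4)) :
    ∃ q, ‖q‖ = 1 ∧ inner ℂ p q = 0 ∧ symplecticForm p q = 0 := by
  let L : EuclideanSpace ℂ (Fin 4) →ₗ[ℂ] ℂ × ℂ :=
    (innerSL ℂ p).toLinearMap.prod (innerSL ℂ (jMul p)).toLinearMap
  have hL : L.ker ≠ ⊥ := LinearMap.ker_ne_bot_of_finrank_lt (by simp)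
  obtain ⟨q, hq, hq0⟩ := Submodule.exists_mem_ne_zero_of_ne_bot hL
  have hn := norm_ne_zero_iff.2 hq0
  have h : inner ℂ p q = 0 ∧ inner ℂ (jMul p) q = 0 := by
    simpa [L] using LinearMap.mem_ker.1 hq
  refine ⟨((‖q‖ : ℂ)⁻¹) • q, ?_, ?_, ?_⟩
  · simp [norm_smul, hn]
  · rw [inner_smul_right, h.1, mul_zero]
  · rw [symplecticForm_smul_right, ← inner_jMul_left, h.2, mul_zero]

/-- Moving p and N along the Hopf fibre by l multiplies σ(p,N) by l²; a suitable square root makes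
the 𝓓₁-coefficient of N real. -/
theorem exists_phase (α : ℂ) : ∃ l : ℂ, ‖l‖ = 1 ∧ ∃ r : ℝ, l * l * α = r := by
  rcases eq_or_ne α 0 with rfl | hα
  · exact ⟨1, by simp, 0, by simp⟩
  have hn : (‖α‖ : ℂ) ≠ 0 := by exact_mod_cast norm_ne_zero_iff.2 hα
  obtain ⟨l, hl⟩ := IsAlgClosed.exists_pow_nat_eq (‖α‖ / α : ℂ) (n := 2) (by norm_num)
  refine ⟨l, ?_, ‖α‖, ?_⟩
  · have h : ‖l‖ ^ 2 = 1 := by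
      rw [← norm_pow, hl]
      simp [hα]
    exact (pow_eq_one_iff_of_nonneg (norm_nonneg _) two_ne_zero).1 h
  · rw [← sq, hl]
    field_simp

/-- A horizontal vector `N` at a point `p` of the unit sphere is brought into a normal form by an
isometry. -/
theorem exists_frame {p N : EuclideanSpace ℂ (Fin 4)} (hp : ‖p‖ = 1) (hN : inner ℂ p N = 0) :
    ∃ A : EuclideanSpace ℂ (Fin 4) →L[ℂ] EuclideanSpace ℂ (Fin 4), IsSymplecticIsometry A ∧
      ∃ (l : ℂ) (r s : ℝ), ‖l‖ = 1 ∧ A (homCoord 0 0) = l • p ∧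
        A (homDir 0 ![(r : ℂ), (s : ℂ), 0]) = l • N := by
  obtain ⟨l, hl, r, hr⟩ := exists_phase (symplecticForm p N)
  have hll : (starRingEnd ℂ) l * l = 1 := by rw [Complex.conj_mul', hl]; simp
  have hp' : ‖l • p‖ = 1 := by rw [norm_smul, hl, hp, one_mul]
  -- The 𝓓₂-component of lN: the 𝓓₁-component is σ(lp, lN) · j(lp), and σ(lp, lN) = l² σ(p,N) = r.
  set n : EuclideanSpace ℂ (Fin 4) := l • N - (r : ℂ) • jMul (l • p) with hn
  have hn1 : inner ℂ (l • p) n = 0 := by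
    rw [hn, inner_sub_right, inner_smul_right, inner_smul_right, inner_smul_left, hN,
      inner_jMul_right, symplecticForm_self]
    simp
  have hn2 : symplecticForm (l • p) n = 0 := by
    rw [← inner_jMul_left, hn, inner_sub_right, inner_smul_right, inner_smul_right,
      inner_jMul_jMul, inner_self_eq_norm_sq_to_K, hp', inner_jMul_left, symplecticForm_smul_left,
      ← mul_assoc, hr]
    simp
  obtain ⟨q, s, hq, hpq, hjpq, hs⟩ : ∃ (q : EuclideanSpace ℂ (Fin 4)) (s : ℝ), ‖q‖ = 1 ∧
      inner ℂ (l • p) q = 0 ∧ symplecticForm (l • p) q = 0 ∧ n = (s : ℂ) • q := by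
    rcases eq_or_ne n 0 with h0 | h0
    · obtain ⟨q, h1, h2, h3⟩ := exists_unit_orthogonal (l • p)
      exact ⟨q, 0, h1, h2, h3, by simp [h0]⟩
    · have hn0 := norm_ne_zero_iff.2 h0
      have hn0' : (‖n‖ : ℂ) ≠ 0 := by exact_mod_cast hn0
      refine ⟨(‖n‖ : ℂ)⁻¹ • n, ‖n‖, ?_, ?_, ?_, ?_⟩
      · simp [norm_smul, hn0]
      · rw [inner_smul_right, hn1, mul_zero]
      · rw [symplecticForm_smul_right, hn2, mul_zero]
      · rw [smul_smul, mul_inv_cancel₀ hn0', one_smul]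
  have e1 : ∀ w, homCoord 0 w 1 = w 0 := fun w => homCoord_succAbove 0 w 0
  have e2 : ∀ w, homCoord 0 w 2 = w 1 := fun w => homCoord_succAbove 0 w 1
  have e3 : ∀ w, homCoord 0 w 3 = w 2 := fun w => homCoord_succAbove 0 w 2
  have d1 : ∀ w, homDir 0 w 1 = w 0 := fun w => homDir_succAbove 0 w 0
  have d2 : ∀ w, homDir 0 w 2 = w 1 := fun w => homDir_succAbove 0 w 1
  have d3 : ∀ w, homDir 0 w 3 = w 2 := fun w => homDir_succAbove 0 w 2
  refine ⟨frameMap (l • p) q, isSymplecticIsometry_frameMap hp' hq hpq hjpq, l, r, s, hl, ?_, ?_⟩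
  · rw [frameMap_apply, e1, e2, e3]
    simp
  · rw [frameMap_apply, d1, d2, d3]
    have : l • N = (r : ℂ) • jMul (l • p) + n := by rw [hn]; abel
    rw [this, hs]
    simp

/-- A local isometry from the centre of the affine chart `0` to a given point brings a given tangent
vector into a normal form. -/
theorem exists_adapted_isometry (a : ℝ) (i : Fin 4) (w N : Fin 3 → ℂ) :
    ∃ (φ : (Fin 3 → ℂ) → (Fin 3 → ℂ)) (V : Set (Fin 3 → ℂ)) (c : ℂ) (r s : ℝ),
      IsImmersionOn φ V ∧ 0 ∈ V ∧ φ 0 = w ∧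
      (∀ y ∈ V, pullbackMetric (metric a i) φ y = metric a 0 y) ∧
      fderiv ℝ φ 0 ![(r : ℂ), (s : ℂ), 0] = N ∧ c ≠ 0 ∧
      (∀ u, symplecticForm (homCoord i w) (homDir i (fderiv ℝ φ 0 u)) = c ^ 2 * u 0) ∧
      ∀ u v, u 0 = 0 → v 0 = 0 →
        symplecticForm (homDir i (fderiv ℝ φ 0 u)) (homDir i (fderiv ℝ φ 0 v)) =
          c ^ 2 * (u 1 * v 2 - u 2 * v 1) := by
  obtain ⟨A, hA, l, r, s, hl, hA0, hAN⟩ :=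
    exists_frame (norm_spherePoint i w) (inner_horizontalLift i w N)
  have hn := norm_ne_zero_iff.2 (homCoord_ne_zero i w)
  have hn' : (‖homCoord i w‖ : ℂ) ≠ 0 := by exact_mod_cast hn
  have hl0 : l ≠ 0 := norm_ne_zero_iff.1 (by rw [hl]; exact one_ne_zero)
  have hc : A (homCoord 0 0) i = l * (‖homCoord i w‖ : ℂ)⁻¹ := by
    rw [hA0]
    simp [spherePoint]
  have hc0 : A (homCoord 0 0) i ≠ 0 := by
    rw [hc]
    exact mul_ne_zero hl0 (inv_ne_zero hn')
  have hφ0 : homCoord i w = (A (homCoord 0 0) i)⁻¹ • A (homCoord 0 0) := by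
    rw [hc, hA0, spherePoint, smul_smul, smul_smul]
    have : (l * (‖homCoord i w‖ : ℂ)⁻¹)⁻¹ * (l * (‖homCoord i w‖ : ℂ)⁻¹) = 1 :=
      inv_mul_cancel₀ (mul_ne_zero hl0 (inv_ne_zero hn'))
    rw [mul_assoc, this, one_smul]
  -- Affine directions have i-th coordinate 0 and position vectors have 1, so identities modulo the
  -- position vector determine affine vectors.
  have hinj : ∀ (u : Fin 3 → ℂ) (μ : ℂ), homDir i u = μ • homCoord i w → u = 0 := by
    intro u μ h
    have h0 := congrArg (fun x : EuclideanSpace ℂ (Fin 4) => x i) h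
    simp at h0
    rw [← h0, zero_smul] at h
    funext k
    have hk := congrArg (fun x : EuclideanSpace ℂ (Fin 4) => x (i.succAbove k)) h
    simpa using hk
  have hS0 : ∀ u, symplecticForm (homCoord 0 0) (homDir 0 u) = u 0 := by
    intro u
    have e1 : homCoord 0 0 1 = 0 := homCoord_succAbove 0 0 0
    have e2 : homCoord 0 0 2 = 0 := homCoord_succAbove 0 0 1
    have e3 : homCoord 0 0 3 = 0 := homCoord_succAbove 0 0 2
    have d1 : homDir 0 u 1 = u 0 := homDir_succAbove 0 u 0
    rw [symplecticForm, e1, e2, e3, d1]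
    simp
  have hS1 : ∀ u v, symplecticForm (homDir 0 u) (homDir 0 v) = u 1 * v 2 - u 2 * v 1 := by
    intro u v
    have d2 : ∀ w, homDir 0 w 2 = w 1 := fun w => homDir_succAbove 0 w 1
    have d3 : ∀ w, homDir 0 w 3 = w 2 := fun w => homDir_succAbove 0 w 2
    rw [symplecticForm, d2, d2, d3, d3]
    simp
  -- The constant c normalises the i-th coordinate of the image of the centre to 1; σ is bilinear,
  -- hence the factor c².
  refine ⟨affineMap i A, {w | A (homCoord 0 w) i ≠ 0}, (A (homCoord 0 0) i)⁻¹, r, s,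
    hA.isImmersionOn_affineMap i, hc0, ?_, fun y hy => hA.pullbackMetric_affineMap a hy, ?_,
    inv_ne_zero hc0, ?_, ?_⟩
  · have h : homDir i (affineMap i A 0 - w) = (0 : ℂ) • homCoord i w := by
      have h1 := homCoord_eq_add i (affineMap i A 0)
      have h2 := homCoord_eq_add i w
      rw [affineMap, homCoord_affineCoord i hc0, ← hφ0] at h1
      rw [map_sub, zero_smul, sub_eq_zero]
      exact add_left_cancel (h1.symm.trans h2)
    exact sub_eq_zero.1 (hinj _ _ h)
  · obtain ⟨μ, hμ⟩ := exists_homDir_fderiv_affineMap hc0 ![(r : ℂ), (s : ℂ), 0]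
    rw [hAN, horizontalLift_apply, hc, hA0, spherePoint, smul_smul, smul_smul] at hμ
    have h1 : (l * (‖homCoord i w‖ : ℂ)⁻¹)⁻¹ * (l * (‖homCoord i w‖ : ℂ)⁻¹) = 1 :=
      inv_mul_cancel₀ (mul_ne_zero hl0 (inv_ne_zero hn'))
    rw [mul_assoc, h1, one_smul] at hμ
    rw [← sub_eq_zero]
    refine hinj _ (μ * (l * (‖homCoord i w‖ : ℂ)⁻¹) -
      inner ℂ ((‖homCoord i w‖ : ℂ)⁻¹ • homCoord i w) (homDir i N) * (‖homCoord i w‖ : ℂ)⁻¹) ?_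
    rw [map_sub, hμ]
    module
  · intro u
    obtain ⟨μ, hμ⟩ := exists_homDir_fderiv_affineMap hc0 u
    rw [hμ, hφ0]
    simp only [symplecticForm_smul_left, symplecticForm_add_right, symplecticForm_smul_right,
      hA.symplecticForm_map, symplecticForm_self, hS0]
    ring
  -- Both vectors are in the kernel of the contact form at the centre, so the unknown multiples of
  -- the position vector do not contribute.
  · intro u v hu hv
    obtain ⟨μ, hμ⟩ := exists_homDir_fderiv_affineMap hc0 u
    obtain ⟨ν, hν⟩ := exists_homDir_fderiv_affineMap hc0 v
    rw [hμ, hν]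
    simp only [symplecticForm_smul_left, symplecticForm_add_right, symplecticForm_smul_right,
      symplecticForm_add_left, hA.symplecticForm_map, symplecticForm_self, hS0, hS1,
      symplecticForm_swap (homDir 0 u) (homCoord 0 0), hu, hv]
    ring

end

end CP3

namespace CP3

noncomputable section

set_option maxSynthPendingDepth 3

open LocalRiemannian

/-! ## The curvature tensor at the centre of the affine chart `0` -/

/-- The standard hermitian form of `ℂ³`. -/
def herm (u v : Fin 3 → ℂ) : ℂ := star (u 0) * v 0 + star (u 1) * v 1 + star (u 2) * v 2

/-- The complex symplectic form of `𝓓₂` at the centre of the affine chart `0`. -/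
def contactForm (u v : Fin 3 → ℂ) : ℂ := u 1 * v 2 - u 2 * v 1

/-- The numerator of the metric coefficients. -/
def metricNum (a : ℝ) (y u v : Fin 3 → ℂ) : ℝ :=
  a * (herm u v * (1 + herm y y) - herm u y * herm y v).re +
    (1 - a) * (star (u 0 + contactForm y u) * (v 0 + contactForm y v)).re

/-- The derivative of `metricNum` at `y` in the direction `X`. -/
def metricNumDeriv (a : ℝ) (y X u v : Fin 3 → ℂ) : ℝ :=
  a * (herm u v * (herm y X + herm X y) - herm u X * herm y v - herm u y * herm X v).re +
    (1 - a) * (star (contactForm X u) * (v 0 + contactForm y v) +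
      star (u 0 + contactForm y u) * contactForm X v).re

/-- The second derivative of the metric coefficients at the centre. -/
def metricSecondDeriv (a : ℝ) (X Y u v : Fin 3 → ℂ) : ℝ :=
  a * (herm u v * (herm X Y + herm Y X) - herm u Y * herm X v - herm u X * herm Y v).re +
    (1 - a) * (star (contactForm Y u) * contactForm X v +
      star (contactForm X u) * contactForm Y v).re
    - 4 * (herm X Y).re * (a * (herm u v).re + (1 - a) * (star (u 0) * v 0).re)

theorem metric_zero_eq (a : ℝ) (y u v : Fin 3 → ℂ) :
    metric a 0 y u v = metricNum a y u v / (1 + (herm y y).re) ^ 2 := by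
  have e1 : homCoord 0 y 1 = y 0 := homCoord_succAbove 0 y 0
  have e2 : homCoord 0 y 2 = y 1 := homCoord_succAbove 0 y 1
  have e3 : homCoord 0 y 3 = y 2 := homCoord_succAbove 0 y 2
  have d1 : ∀ w, homDir 0 w 1 = w 0 := fun w => homDir_succAbove 0 w 0
  have d2 : ∀ w, homDir 0 w 2 = w 1 := fun w => homDir_succAbove 0 w 1
  have d3 : ∀ w, homDir 0 w 3 = w 2 := fun w => homDir_succAbove 0 w 2
  have h1 : (‖homCoord 0 y‖ : ℂ) ^ 2 = 1 + herm y y := by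
    have h := inner_self_eq_norm_sq_to_K (𝕜 := ℂ) (homCoord 0 y)
    refine h.symm.trans ?_
    simp only [PiLp.inner_apply, Fin.sum_univ_four, e1, e2, e3, homCoord_same, herm]
    simp [Complex.conj_mul']
    ring
  have h2 : ‖homCoord 0 y‖ ^ 2 = 1 + (herm y y).re := by
    have := congrArg Complex.re h1
    rw [← Complex.ofReal_pow, Complex.ofReal_re] at this
    simpa using this
  have h3 : inner ℂ (homDir 0 u) (homDir 0 v) = herm u v := by
    simp only [PiLp.inner_apply, Fin.sum_univ_four, d1, d2, d3, homDir_same, herm]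
    simp
    ring
  have h4 : inner ℂ (homDir 0 u) (homCoord 0 y) = herm u y := by
    simp only [PiLp.inner_apply, Fin.sum_univ_four, d1, d2, d3, homDir_same, herm, e1, e2, e3]
    simp
    ring
  have h5 : inner ℂ (homCoord 0 y) (homDir 0 v) = herm y v := by
    simp only [PiLp.inner_apply, Fin.sum_univ_four, d1, d2, d3, homDir_same, herm, e1, e2, e3]
    simp
    ring
  have h6 : ∀ u, symplecticForm (homCoord 0 y) (homDir 0 u) = u 0 + contactForm y u := by
    intro u
    simp only [symplecticForm, d1, d2, d3, homDir_same, e1, e2, e3, homCoord_same, contactForm]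
    ring
  rw [metric_eq_homMetric, homMetric, h1, h2, h3, h4, h5, h6, h6, metricNum]

theorem herm_add_left (u v w : Fin 3 → ℂ) : herm (u + v) w = herm u w + herm v w := by
  simp [herm]
  ring

theorem herm_add_right (u v w : Fin 3 → ℂ) : herm w (u + v) = herm w u + herm w v := by
  simp [herm]
  ring

theorem herm_smul_left (t : ℝ) (u v : Fin 3 → ℂ) : herm (t • u) v = t * herm u v := by
  simp [herm]
  ring

theorem herm_smul_right (t : ℝ) (u v : Fin 3 → ℂ) : herm u (t • v) = t * herm u v := by
  simp [herm]
  ring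

theorem herm_swap_re (u v : Fin 3 → ℂ) : (herm u v).re = (herm v u).re := by
  simp [herm]
  ring

theorem herm_zero_left (u : Fin 3 → ℂ) : herm 0 u = 0 := by simp [herm]

theorem herm_zero_right (u : Fin 3 → ℂ) : herm u 0 = 0 := by simp [herm]

theorem contactForm_add_left (u v w : Fin 3 → ℂ) :
    contactForm (u + v) w = contactForm u w + contactForm v w := by
  simp [contactForm]
  ring

theorem contactForm_smul_left (t : ℝ) (u v : Fin 3 → ℂ) :
    contactForm (t • u) v = t * contactForm u v := by
  simp [contactForm]
  ring

theorem contactForm_zero_left (u : Fin 3 → ℂ) : contactForm 0 u = 0 := by simp [contactForm]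

theorem one_add_herm_self_pos (y : Fin 3 → ℂ) : 0 < 1 + (herm y y).re := by
  have : (herm y y).re = Complex.normSq (y 0) + Complex.normSq (y 1) + Complex.normSq (y 2) := by
    simp [herm, Complex.normSq_apply]
  rw [this]
  have h0 := Complex.normSq_nonneg (y 0)
  have h1 := Complex.normSq_nonneg (y 1)
  have h2 := Complex.normSq_nonneg (y 2)
  linarith

/-- The numerator is quadratic in the base point, so this expansion is exact. Derivatives of the
metric can then be computed as line derivatives of rational functions of t. -/
theorem metricNum_line (a : ℝ) (y X u v : Fin 3 → ℂ) (t : ℝ) :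
    metricNum a (y + t • X) u v =
      metricNum a y u v + t * metricNumDeriv a y X u v + t ^ 2 *
        (a * (herm u v * herm X X - herm u X * herm X v).re +
          (1 - a) * (star (contactForm X u) * contactForm X v).re) := by
  simp only [metricNum, metricNumDeriv, herm_add_left, herm_add_right, herm_smul_left,
    herm_smul_right, contactForm_add_left, contactForm_smul_left]
  simp
  ring

theorem norm_line (y X : Fin 3 → ℂ) (t : ℝ) :
    1 + (herm (y + t • X) (y + t • X)).re =
      (1 + (herm y y).re) + t * (2 * (herm y X).re) + t ^ 2 * (herm X X).re := by
  simp only [herm_add_left, herm_add_right, herm_smul_left, herm_smul_right]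
  have := herm_swap_re y X
  simp
  rw [this]
  ring

theorem hasDerivAt_quadratic (p q r : ℝ) :
    HasDerivAt (fun t : ℝ => p + t * q + t ^ 2 * r) q 0 := by
  have h := (((hasDerivAt_id (0 : ℝ)).mul_const q).const_add p).add
    (((hasDerivAt_id (0 : ℝ)).pow 2).mul_const r)
  exact h.congr_deriv (by simp)

theorem fderiv_metric_zero (a : ℝ) (ha : 0 < a) (y X u v : Fin 3 → ℂ) :
    fderiv ℝ (metric a 0) y X u v =
      metricNumDeriv a y X u v / (1 + (herm y y).re) ^ 2
        - 4 * metricNum a y u v * (herm y X).re / (1 + (herm y y).re) ^ 3 := by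
  have hd := (isRiemannianOn_metric a ha 0).differentiableAt (Set.mem_univ y)
  have hd' : DifferentiableAt ℝ (fun z => metric a 0 z u v) y :=
    ((hd.hasFDerivAt.clm_apply (hasFDerivAt_const u y)).clm_apply
      (hasFDerivAt_const v y)).differentiableAt
  rw [← fderiv_apply_apply hd]
  have hl := hd'.hasFDerivAt.hasLineDerivAt X
  rw [HasLineDerivAt] at hl
  simp only [metric_zero_eq, metricNum_line, norm_line] at hl
  have hn := (one_add_herm_self_pos y).ne'
  have h := (hasDerivAt_quadratic (metricNum a y u v) (metricNumDeriv a y X u v)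
    (a * (herm u v * herm X X - herm u X * herm X v).re +
          (1 - a) * (star (contactForm X u) * contactForm X v).re)).div
    ((hasDerivAt_quadratic (1 + (herm y y).re) (2 * (herm y X).re) (herm X X).re).pow 2)
    (by simpa using hn)
  simp only [metric_zero_eq]
  refine (hl.unique h).trans ?_
  simp
  field_simp
  ring

theorem fderiv_metric_zero_zero (a : ℝ) (ha : 0 < a) (X u v : Fin 3 → ℂ) :
    fderiv ℝ (metric a 0) 0 X u v =
      (1 - a) * (star (contactForm X u) * v 0 + star (u 0) * contactForm X v).re := by
  rw [fderiv_metric_zero a ha]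
  simp [metricNumDeriv, herm_zero_left, herm_zero_right, contactForm_zero_left]

theorem metric_zero_zero (a : ℝ) (u v : Fin 3 → ℂ) :
    metric a 0 0 u v = a * (herm u v).re + (1 - a) * (star (u 0) * v 0).re := by
  rw [metric_zero_eq]
  simp [metricNum, herm_zero_left, herm_zero_right, contactForm_zero_left]

/-- The term with factor 4 in `metricSecondDeriv` comes from the denominator (1 + |y|²)², whose
first derivative vanishes at the centre. -/
theorem hasDerivAt_fderiv_metric (a : ℝ) (ha : 0 < a) (X Y u v : Fin 3 → ℂ) :
    HasDerivAt (fun t : ℝ => fderiv ℝ (metric a 0) (t • X) Y u v) (metricSecondDeriv a X Y u v)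
      0 := by
  have h1 : ∀ t : ℝ, metricNumDeriv a (t • X) Y u v =
      metricNumDeriv a 0 Y u v + t *
        (a * (herm u v * (herm X Y + herm Y X) - herm u Y * herm X v - herm u X * herm Y v).re +
          (1 - a) * (star (contactForm Y u) * contactForm X v +
            star (contactForm X u) * contactForm Y v).re) + t ^ 2 * 0 := by
    intro t
    simp only [metricNumDeriv, herm_smul_left, herm_smul_right, contactForm_smul_left,
      herm_zero_left, herm_zero_right, contactForm_zero_left]
    simp
    ring
  have h2 : ∀ t : ℝ, metricNum a (t • X) u v = metricNum a 0 u v + t * metricNumDeriv a 0 X u v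
      + t ^ 2 * (a * (herm u v * herm X X - herm u X * herm X v).re +
          (1 - a) * (star (contactForm X u) * contactForm X v).re) := by
    intro t
    rw [← metricNum_line, zero_add]
  have h3 : ∀ t : ℝ, 1 + (herm (t • X) (t • X)).re = 1 + t * 0 + t ^ 2 * (herm X X).re := by
    intro t
    have := norm_line 0 X t
    simpa [herm_zero_left] using this
  have h4 : ∀ t : ℝ, (herm (t • X) Y).re = 0 + t * (herm X Y).re + t ^ 2 * 0 := by
    intro t
    rw [herm_smul_left, Complex.re_ofReal_mul]
    ring
  simp only [fderiv_metric_zero a ha, h1, h2, h3, h4]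
  have hn := hasDerivAt_quadratic 1 0 (herm X X).re
  have h := ((hasDerivAt_quadratic (metricNumDeriv a 0 Y u v)
      (a * (herm u v * (herm X Y + herm Y X) - herm u Y * herm X v - herm u X * herm Y v).re +
          (1 - a) * (star (contactForm Y u) * contactForm X v +
            star (contactForm X u) * contactForm Y v).re) 0).div (hn.pow 2) (by simp)).sub
    ((((hasDerivAt_quadratic (metricNum a 0 u v) (metricNumDeriv a 0 X u v)
      (a * (herm u v * herm X X - herm u X * herm X v).re +
          (1 - a) * (star (contactForm X u) * contactForm X v).re)).const_mul 4).mul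
      (hasDerivAt_quadratic 0 (herm X Y).re 0)).div (hn.pow 3) (by simp))
  refine h.congr_deriv ?_
  simp [metricSecondDeriv, metricNum, herm_zero_left, herm_zero_right, contactForm_zero_left]
  ring

/-- The Christoffel symbols at the centre of the affine chart `0`. -/
def centralChristoffel (a : ℝ) (X Y : Fin 3 → ℂ) : Fin 3 → ℂ :=
  ![0, -(((1 - a) / a : ℝ) * (Y 0 * star (X 2) + X 0 * star (Y 2))),
    ((1 - a) / a : ℝ) * (Y 0 * star (X 1) + X 0 * star (Y 1))]

/-- The Fubini–Study part is stationary at the centre, so only the contact term with its factor 1 -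
a contributes; division by a is the inverse metric on 𝓓₂. -/
theorem christoffel_metric_zero (a : ℝ) (ha : 0 < a) (X Y : Fin 3 → ℂ) :
    christoffel (metric a 0) 0 X Y = centralChristoffel a X Y := by
  have hG := isRiemannianOn_metric a ha 0
  refine hG.ext (Set.mem_univ 0) fun W => ?_
  rw [hG.apply_christoffel (Set.mem_univ 0), fderiv_metric_zero_zero a ha,
    fderiv_metric_zero_zero a ha, fderiv_metric_zero_zero a ha, metric_zero_zero]
  simp [herm, contactForm, centralChristoffel]
  field_simp
  ring

/-- The curvature tensor `g(R(X, Y)Z, W)` at the centre of the affine chart `0`. -/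
def centralCurvature (a : ℝ) (X Y Z W : Fin 3 → ℂ) : ℝ :=
  1 / 2 * (metricSecondDeriv a X Y Z W + metricSecondDeriv a X Z Y W - metricSecondDeriv a X W Y Z)
    - 1 / 2 *
      (metricSecondDeriv a Y X Z W + metricSecondDeriv a Y Z X W - metricSecondDeriv a Y W X Z)
    - a * (herm (centralChristoffel a Y Z) (centralChristoffel a X W)).re
    + a * (herm (centralChristoffel a X Z) (centralChristoffel a Y W)).re

theorem apply_curvature_metric_zero (a : ℝ) (ha : 0 < a) (X Y Z W : Fin 3 → ℂ) :
    metric a 0 0 (curvature (metric a 0) 0 X Y Z) W = centralCurvature a X Y Z W := by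
  have hG := isRiemannianOn_metric a ha 0
  have hD : ContDiff ℝ ∞ (fderiv ℝ (metric a 0)) :=
    (contDiffOn_univ.1 hG.contDiffOn).fderiv_right (by simp)
  have key : ∀ A B : Fin 3 → ℂ,
      fderiv ℝ (fun y => christoffelForm (metric a 0) y A Z W) 0 B =
      1 / 2 * (metricSecondDeriv a B A Z W + metricSecondDeriv a B Z A W
        - metricSecondDeriv a B W A Z) := by
    intro A B
    have hd : DifferentiableAt ℝ (fun y => christoffelForm (metric a 0) y A Z W) 0 := by
      simp only [christoffelForm_apply]
      have h1 : ∀ u v w, Differentiable ℝ fun y => fderiv ℝ (metric a 0) y u v w := fun u v w =>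
        (((hD.clm_apply contDiff_const).clm_apply contDiff_const).clm_apply
          contDiff_const).differentiable (by simp)
      exact (((h1 _ _ _).add (h1 _ _ _)).sub (h1 _ _ _)).const_mul _ 0
    have hl := hd.hasFDerivAt.hasLineDerivAt B
    rw [HasLineDerivAt] at hl
    simp only [christoffelForm_apply, zero_add] at hl
    have h := (((hasDerivAt_fderiv_metric a ha B A Z W).add
      (hasDerivAt_fderiv_metric a ha B Z A W)).sub
      (hasDerivAt_fderiv_metric a ha B W A Z)).const_mul (1 / 2)
    simp only [christoffelForm_apply]
    exact hl.unique h
  -- The Christoffel symbols have no 𝓓₁-component, so the metric pairs them by a times the hermitian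
  -- form.
  have h0 : ∀ X Y, centralChristoffel a X Y 0 = 0 := fun X Y => rfl
  rw [hG.apply_curvature (Set.mem_univ 0), key, key]
  simp only [christoffel_metric_zero a ha, metric_zero_zero, h0, centralCurvature]
  simp

end

end CP3

namespace CP3

noncomputable section

/-! ## Algebraic consequences for a hyperplane of the central tangent space -/

/-- The three tangent vectors are orthogonal to (r, s, 0), and the third to the first two. This
component therefore vanishes in both the Codazzi-like and the umbilical case and detects the 𝓓₂-part
of the normal, for every a. -/
theorem centralCurvature_normal (a : ℝ) (r s : ℝ) :
    centralCurvature a ![0, Complex.I, 0] ![0, 0, 1] ![0, 0, Complex.I] ![r, s, 0] = -s := by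
  simp [centralCurvature, metricSecondDeriv, herm, contactForm, centralChristoffel]
  ring

/-- The induced curvature tensor of a hyperplane of the central tangent space is not the one of a
hypersurface of constant curvature. -/
theorem not_gauss_constant_curvature {a : ℝ} (ha : 0 < a) (r s c : ℝ) (hrs : r ≠ 0 ∨ s ≠ 0)
    (h : (Fin 3 → ℂ) → (Fin 3 → ℂ) → ℝ)
    (hsymm : ∀ X Y, metric a 0 0 X ![r, s, 0] = 0 → metric a 0 0 Y ![r, s, 0] = 0 → h X Y = h Y X)
    (hR : ∀ X Y Z W, metric a 0 0 X ![r, s, 0] = 0 → metric a 0 0 Y ![r, s, 0] = 0 →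
      metric a 0 0 Z ![r, s, 0] = 0 → metric a 0 0 W ![r, s, 0] = 0 →
      centralCurvature a X Y Z W =
        c * (metric a 0 0 Y Z * metric a 0 0 X W - metric a 0 0 X Z * metric a 0 0 Y W)
          - h Y Z * h X W + h X Z * h Y W) : False := by
  have ha0 := ha.ne'
  set e1 : Fin 3 → ℂ := ![Complex.I, 0, 0] with he1
  set e2 : Fin 3 → ℂ := ![0, Complex.I, 0] with he2
  set e3 : Fin 3 → ℂ := ![0, 0, 1] with he3
  set e4 : Fin 3 → ℂ := ![0, 0, Complex.I] with he4
  have t1 : metric a 0 0 e1 ![r, s, 0] = 0 := by simp [metric_zero_zero, herm, he1]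
  have t2 : metric a 0 0 e2 ![r, s, 0] = 0 := by simp [metric_zero_zero, herm, he2]
  have t3 : metric a 0 0 e3 ![r, s, 0] = 0 := by simp [metric_zero_zero, herm, he3]
  have t4 : metric a 0 0 e4 ![r, s, 0] = 0 := by simp [metric_zero_zero, herm, he4]
  have h32 := hsymm _ _ t3 t2
  have h42 := hsymm _ _ t4 t2
  have h43 := hsymm _ _ t4 t3
  have g22 : metric a 0 0 e2 e2 = a := by simp [metric_zero_zero, herm, he2]
  have g33 : metric a 0 0 e3 e3 = a := by simp [metric_zero_zero, herm, he3]
  have g44 : metric a 0 0 e4 e4 = a := by simp [metric_zero_zero, herm, he4]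
  have g23 : metric a 0 0 e2 e3 = 0 := by simp [metric_zero_zero, herm, he2, he3]
  have g32 : metric a 0 0 e3 e2 = 0 := by simp [metric_zero_zero, herm, he2, he3]
  have g24 : metric a 0 0 e2 e4 = 0 := by simp [metric_zero_zero, herm, he2, he4]
  have g42 : metric a 0 0 e4 e2 = 0 := by simp [metric_zero_zero, herm, he2, he4]
  have g34 : metric a 0 0 e3 e4 = 0 := by simp [metric_zero_zero, herm, he3, he4]
  have g43 : metric a 0 0 e4 e3 = 0 := by simp [metric_zero_zero, herm, he3, he4]
  -- Each `Mijkl` says that the minor of h with rows i, j and columns k, l equals the curvature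
  -- component plus c times the same minor of the metric.
  have M2323 := hR _ _ _ _ t2 t3 t2 t3
  have M2424 := hR _ _ _ _ t2 t4 t2 t4
  have M3434 := hR _ _ _ _ t3 t4 t3 t4
  have M2324 := hR _ _ _ _ t2 t3 t2 t4
  have M2334 := hR _ _ _ _ t2 t3 t3 t4
  have M2434 := hR _ _ _ _ t2 t4 t3 t4
  have R2323 : centralCurvature a e2 e3 e2 e3 = -4 * a + 3 := by
    simp [centralCurvature, metricSecondDeriv, herm, contactForm, centralChristoffel, he2, he3]
    ring
  have R2424 : centralCurvature a e2 e4 e2 e4 = -4 * a + 3 := by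
    simp [centralCurvature, metricSecondDeriv, herm, contactForm, centralChristoffel, he2, he4]
    ring
  have R3434 : centralCurvature a e3 e4 e3 e4 = -4 * a := by
    simp [centralCurvature, metricSecondDeriv, herm, contactForm, centralChristoffel, he3, he4]
    ring
  have R2324 : centralCurvature a e2 e3 e2 e4 = 0 := by
    simp [centralCurvature, metricSecondDeriv, herm, contactForm, centralChristoffel, he2, he3, he4]
  have R2334 : centralCurvature a e2 e3 e3 e4 = 0 := by
    simp [centralCurvature, metricSecondDeriv, herm, contactForm, centralChristoffel, he2, he3, he4]
  have R2434 : centralCurvature a e2 e4 e3 e4 = 0 := by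
    simp [centralCurvature, metricSecondDeriv, herm, contactForm, centralChristoffel, he2, he3, he4]
  rw [R2323, g22, g33, g23, g32, h32] at M2323
  rw [R2424, g22, g44, g24, g42, h42] at M2424
  rw [R3434, g33, g44, g34, g43, h43] at M3434
  rw [R2324, g22, g34, g24, g32, h32] at M2324
  rw [R2334, g23, g34, g33, g24] at M2334
  rw [R2434, g23, g43, g24, g44, h43] at M2434
  by_cases hr : r = 0
  · have hs : s ≠ 0 := hrs.resolve_left (not_not.2 hr)
    subst hr
    set e5 : Fin 3 → ℂ := ![1, 0, 0] with he5
    have t5 : metric a 0 0 e5 ![((0 : ℝ) : ℂ), s, 0] = 0 := by simp [metric_zero_zero, herm, he5]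
    have h21 := hsymm _ _ t2 t1
    have h31 := hsymm _ _ t3 t1
    have h41 := hsymm _ _ t4 t1
    have h51 := hsymm _ _ t5 t1
    have h53 := hsymm _ _ t5 t3
    have h54 := hsymm _ _ t5 t4
    have g11 : metric a 0 0 e1 e1 = 1 := by simp [metric_zero_zero, herm, he1]
    have g55 : metric a 0 0 e5 e5 = 1 := by simp [metric_zero_zero, herm, he5]
    have g12 : metric a 0 0 e1 e2 = 0 := by simp [metric_zero_zero, herm, he1, he2]
    have g21 : metric a 0 0 e2 e1 = 0 := by simp [metric_zero_zero, herm, he2, he1]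
    have g13 : metric a 0 0 e1 e3 = 0 := by simp [metric_zero_zero, herm, he1, he3]
    have g31 : metric a 0 0 e3 e1 = 0 := by simp [metric_zero_zero, herm, he3, he1]
    have g14 : metric a 0 0 e1 e4 = 0 := by simp [metric_zero_zero, herm, he1, he4]
    have g41 : metric a 0 0 e4 e1 = 0 := by simp [metric_zero_zero, herm, he4, he1]
    have g15 : metric a 0 0 e1 e5 = 0 := by simp [metric_zero_zero, herm, he1, he5]
    have g51 : metric a 0 0 e5 e1 = 0 := by simp [metric_zero_zero, herm, he5, he1]
    have g35 : metric a 0 0 e3 e5 = 0 := by simp [metric_zero_zero, herm, he3, he5]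
    have g53 : metric a 0 0 e5 e3 = 0 := by simp [metric_zero_zero, herm, he5, he3]
    have g45 : metric a 0 0 e4 e5 = 0 := by simp [metric_zero_zero, herm, he4, he5]
    have g54 : metric a 0 0 e5 e4 = 0 := by simp [metric_zero_zero, herm, he5, he4]
    have R1212 : centralCurvature a e1 e2 e1 e2 = -(1 / a) := by
      simp [centralCurvature, metricSecondDeriv, herm, contactForm, centralChristoffel, he1, he2]
      field_simp
      ring
    have R1313 : centralCurvature a e1 e3 e1 e3 = -(1 / a) := by
      simp [centralCurvature, metricSecondDeriv, herm, contactForm, centralChristoffel, he1, he3]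
      field_simp
      ring
    have R1515 : centralCurvature a e1 e5 e1 e5 = -4 := by
      simp [centralCurvature, metricSecondDeriv, herm, contactForm, centralChristoffel, he1, he5]
      ring
    have R1534 : centralCurvature a e1 e5 e3 e4 = 4 - 2 / a := by
      simp [centralCurvature, metricSecondDeriv, herm, contactForm, centralChristoffel, he1,
        he3, he4, he5]
      field_simp
      ring
    have R1213 : centralCurvature a e1 e2 e1 e3 = 0 := by
      simp [centralCurvature, metricSecondDeriv, herm, contactForm, centralChristoffel, he1,
        he2, he3]
    have R1214 : centralCurvature a e1 e2 e1 e4 = 0 := by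
      simp [centralCurvature, metricSecondDeriv, herm, contactForm, centralChristoffel, he1,
        he2, he4]
    have R1223 : centralCurvature a e1 e2 e2 e3 = 0 := by
      simp [centralCurvature, metricSecondDeriv, herm, contactForm, centralChristoffel, he1,
        he2, he3]
    have R1224 : centralCurvature a e1 e2 e2 e4 = 0 := by
      simp [centralCurvature, metricSecondDeriv, herm, contactForm, centralChristoffel, he1,
        he2, he4]
    have R1234 : centralCurvature a e1 e2 e3 e4 = 0 := by
      simp [centralCurvature, metricSecondDeriv, herm, contactForm, centralChristoffel, he1,
        he2, he3, he4]
    have R1314 : centralCurvature a e1 e3 e1 e4 = 0 := by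
      simp [centralCurvature, metricSecondDeriv, herm, contactForm, centralChristoffel, he1,
        he3, he4]
    have R1323 : centralCurvature a e1 e3 e2 e3 = 0 := by
      simp [centralCurvature, metricSecondDeriv, herm, contactForm, centralChristoffel, he1,
        he2, he3]
    have R1324 : centralCurvature a e1 e3 e2 e4 = 0 := by
      simp [centralCurvature, metricSecondDeriv, herm, contactForm, centralChristoffel, he1,
        he2, he3, he4]
    have R1334 : centralCurvature a e1 e3 e3 e4 = 0 := by
      simp [centralCurvature, metricSecondDeriv, herm, contactForm, centralChristoffel, he1,
        he3, he4]
    have R1434 : centralCurvature a e1 e4 e3 e4 = 0 := by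
      simp [centralCurvature, metricSecondDeriv, herm, contactForm, centralChristoffel, he1,
        he3, he4]
    have R1315 : centralCurvature a e1 e3 e1 e5 = 0 := by
      simp [centralCurvature, metricSecondDeriv, herm, contactForm, centralChristoffel, he1,
        he3, he5]
    have R1415 : centralCurvature a e1 e4 e1 e5 = 0 := by
      simp [centralCurvature, metricSecondDeriv, herm, contactForm, centralChristoffel, he1,
        he4, he5]
    have M1212 := hR _ _ _ _ t1 t2 t1 t2
    simp only [R1212, g21, g12, g11, g22, h21] at M1212
    have M1313 := hR _ _ _ _ t1 t3 t1 t3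
    simp only [R1313, g31, g13, g11, g33, h31] at M1313
    have M1515 := hR _ _ _ _ t1 t5 t1 t5
    simp only [R1515, g51, g15, g11, g55, h51] at M1515
    have M1534 := hR _ _ _ _ t1 t5 t3 t4
    simp only [R1534, g53, g14, g13, g54, h53, h54] at M1534
    have M1213 := hR _ _ _ _ t1 t2 t1 t3
    simp only [R1213, g21, g13, g11, g23, h21] at M1213
    have M1214 := hR _ _ _ _ t1 t2 t1 t4
    simp only [R1214, g21, g14, g11, g24, h21] at M1214
    have M1223 := hR _ _ _ _ t1 t2 t2 t3
    simp only [R1223, g22, g13, g12, g23] at M1223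
    have M1224 := hR _ _ _ _ t1 t2 t2 t4
    simp only [R1224, g22, g14, g12, g24] at M1224
    have M1234 := hR _ _ _ _ t1 t2 t3 t4
    simp only [R1234, g23, g14, g13, g24] at M1234
    have M1314 := hR _ _ _ _ t1 t3 t1 t4
    simp only [R1314, g31, g14, g11, g34, h31] at M1314
    have M1323 := hR _ _ _ _ t1 t3 t2 t3
    simp only [R1323, g32, g13, g12, g33, h32] at M1323
    have M1324 := hR _ _ _ _ t1 t3 t2 t4
    simp only [R1324, g32, g14, g12, g34, h32] at M1324
    have M1334 := hR _ _ _ _ t1 t3 t3 t4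
    simp only [R1334, g33, g14, g13, g34] at M1334
    have M1434 := hR _ _ _ _ t1 t4 t3 t4
    simp only [R1434, g43, g14, g13, g44, h43] at M1434
    have M1315 := hR _ _ _ _ t1 t3 t1 t5
    simp only [R1315, g31, g15, g11, g35, h31] at M1315
    have M1415 := hR _ _ _ _ t1 t4 t1 t5
    simp only [R1415, g41, g15, g11, g45, h41] at M1415
    -- The determinant of h on e1, ..., e4 is expanded by Laplace along rows 1, 2 and along rows 1,
    -- 3. The off-diagonal minors in these rows vanish, so m(12;12) m(34;34) = m(13;13) m(24;24),
    -- and the factors m(34;34) and m(24;24) differ by 3.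
    have k1 : -(1 / a) + c * a = 0 := by
      have : 3 * (-(1 / a) + c * a) = 0 := by
        linear_combination (-(1 / a) + c * a) * M2424 - (-(1 / a) + c * a) * M3434
          + (h e2 e2 * h e4 e4 - h e2 e4 * h e2 e4) * M1313
          - (h e3 e3 * h e4 e4 - h e3 e4 * h e3 e4) * M1212
          + (h e2 e3 * h e4 e4 - h e3 e4 * h e2 e4) * M1213
          - (h e2 e3 * h e3 e4 - h e3 e3 * h e2 e4) * M1214
          - (h e1 e3 * h e4 e4 - h e3 e4 * h e1 e4) * M1223
          + (h e1 e3 * h e3 e4 - h e3 e3 * h e1 e4) * M1224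
          - (h e1 e3 * h e2 e4 - h e2 e3 * h e1 e4) * M1234
          - (h e2 e3 * h e4 e4 - h e2 e4 * h e3 e4) * M1213
          - (h e2 e2 * h e3 e4 - h e2 e3 * h e2 e4) * M1314
          - (h e1 e2 * h e4 e4 - h e2 e4 * h e1 e4) * M1323
          + (h e1 e2 * h e3 e4 - h e2 e3 * h e1 e4) * M1324
          - (h e1 e2 * h e2 e4 - h e2 e2 * h e1 e4) * M1334
      linarith
    have k2 : c * a ^ 2 = 1 := by
      field_simp at k1
      linarith
    -- Plücker relation for rows e3, e4 and columns e1, e5, e3, e4, where two of the three products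
    -- vanish; `k4` is the same for rows e1, e5.
    have k3 : (4 - 2 / a) * (-4 * a + c * a ^ 2) = 0 := by
      linear_combination (4 - 2 / a) * M3434 + (h e3 e3 * h e4 e4 - h e3 e4 * h e3 e4) * M1534
        - (h e3 e5 * h e4 e4 - h e4 e5 * h e3 e4) * M1334
          + (h e3 e5 * h e3 e4 - h e4 e5 * h e3 e3) * M1434
    have k4 : (4 - 2 / a) * (-4 + c) = 0 := by
      linear_combination (4 - 2 / a) * M1515 + (h e1 e1 * h e5 e5 - h e1 e5 * h e1 e5) * M1534
        - (h e1 e5 * h e4 e5 - h e5 e5 * h e1 e4) * M1315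
          + (h e1 e5 * h e3 e5 - h e5 e5 * h e1 e3) * M1415
    rcases eq_or_ne (4 - 2 / a) 0 with h0 | h0
    · have ha2 : a = 1 / 2 := by
        field_simp at h0
        linarith
      have hc : c = 4 := by
        rw [ha2] at k2
        linarith
      subst ha2 hc
      have d23 : (h e2 e2 * h e3 e3 - h e2 e3 * h e2 e3) = 2 := by linear_combination -M2323
      have d24 : (h e2 e2 * h e4 e4 - h e2 e4 * h e2 e4) = 2 := by linear_combination -M2424
      have d34 : (h e3 e3 * h e4 e4 - h e3 e4 * h e3 e4) = -1 := by linear_combination -M3434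
      have z1 : (h e2 e2 * h e3 e4 - h e2 e4 * h e2 e3) = 0 := by linear_combination -M2324
      have z2 : (h e2 e3 * h e3 e4 - h e2 e4 * h e3 e3) = 0 := by linear_combination -M2334
      have z3 : (h e2 e3 * h e4 e4 - h e2 e4 * h e3 e4) = 0 := by linear_combination -M2434
      -- The determinant of the adjugate of a symmetric 3×3 matrix is the square of its determinant.
      -- The adjugate is diagonal here, with entries -1, 2, 2, so that square would be -4.
      have key : (h e2 e2 * (h e3 e3 * h e4 e4 - h e3 e4 * h e3 e4)
        - h e2 e3 * (h e2 e3 * h e4 e4 - h e2 e4 * h e3 e4)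
        + h e2 e4 * (h e2 e3 * h e3 e4 - h e2 e4 * h e3 e3)) ^ 2 =
          (h e3 e3 * h e4 e4 - h e3 e4 * h e3 e4) * (h e2 e2 * h e4 e4
            - h e2 e4 * h e2 e4) * (h e2 e2 * h e3 e3 - h e2 e3 * h e2 e3)
            + 2 * (h e2 e3 * h e4 e4 - h e2 e4 * h e3 e4) * (h e2 e3 * h e3 e4
            - h e2 e4 * h e3 e3) * (h e2 e2 * h e3 e4 - h e2 e4 * h e2 e3)
            - (h e3 e3 * h e4 e4 - h e3 e4 * h e3 e4) * (h e2 e2 * h e3 e4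
              - h e2 e4 * h e2 e3) ^ 2 - (h e2 e2 * h e4 e4
              - h e2 e4 * h e2 e4) * (h e2 e3 * h e3 e4 - h e2 e4 * h e3 e3) ^ 2
            - (h e2 e2 * h e3 e3 - h e2 e3 * h e2 e3) * (h e2 e3 * h e4 e4
              - h e2 e4 * h e3 e4) ^ 2 := by ring
      rw [d23, d24, d34, z1, z2, z3] at key
      have := sq_nonneg (h e2 e2 * -1 - h e2 e3 * 0 + h e2 e4 * 0)
      linarith
    -- Together with c a² = 1 the two factors give a = 1/4 and c = 4, for which c a² = 1/4.
    · have k5 := (mul_eq_zero.1 k3).resolve_left h0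
      have k6 := (mul_eq_zero.1 k4).resolve_left h0
      have ha2 : a = 1 / 4 := by linarith
      have hc : c = 4 := by linarith
      rw [ha2, hc] at k2
      norm_num at k2
  -- Orthogonal to (r, s, 0) because the central metric has weight 1 on the first coordinate and a
  -- on the second.
  · set e5 : Fin 3 → ℂ := ![-(a * s : ℝ), r, 0] with he5
    have t5 : metric a 0 0 e5 ![r, s, 0] = 0 := by
      simp [metric_zero_zero, herm, he5]
      ring
    have M2345 := hR _ _ _ _ t2 t3 t4 t5
    have M2534 := hR _ _ _ _ t2 t5 t3 t4
    have g45 : metric a 0 0 e4 e5 = 0 := by simp [metric_zero_zero, herm, he4, he5]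
    have g25 : metric a 0 0 e2 e5 = 0 := by simp [metric_zero_zero, herm, he2, he5]
    have g35 : metric a 0 0 e3 e5 = 0 := by simp [metric_zero_zero, herm, he3, he5]
    have h54 := hsymm _ _ t5 t4
    have h53 := hsymm _ _ t5 t3
    have R2345 : centralCurvature a e2 e3 e4 e5 = -r := by
      simp [centralCurvature, metricSecondDeriv, herm, contactForm, centralChristoffel, he2, he3,
        he4, he5]
      ring
    have R2534 : centralCurvature a e2 e5 e3 e4 = 2 * r := by
      simp [centralCurvature, metricSecondDeriv, herm, contactForm, centralChristoffel, he2, he3,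
        he4, he5]
      ring
    rw [R2345, g34, g25, g24, g35] at M2345
    rw [R2534, g23, g24, h54, h53] at M2534
    -- Plücker relations on the columns e2, ..., e5, here for rows e2, e3 and in `k2` for rows e3,
    -- e4. The minors 23;24, 23;34 and 24;34 vanish, so one product survives in each.
    have k1 : r * (-4 * a + 3 + c * a ^ 2) = 0 := by
      linear_combination r * M2323 - (h e2 e2 * h e3 e3 - h e2 e3 ^ 2) * M2345
        - (h e2 e5 * h e3 e3 - h e3 e5 * h e2 e3) * M2324
        - (h e3 e5 * h e2 e2 - h e2 e5 * h e2 e3) * M2334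
    have k2 : r * (-4 * a + c * a ^ 2) = 0 := by
      linear_combination r * M3434 + 1 / 2 * (h e3 e3 * h e4 e4 - h e3 e4 ^ 2) * M2534
        - 1 / 2 * (h e3 e5 * h e4 e4 - h e4 e5 * h e3 e4) * M2334
        + 1 / 2 * (h e3 e5 * h e3 e4 - h e4 e5 * h e3 e3) * M2434
    have k3 : r * 3 = 0 := by linear_combination k1 - k2
    exact hr (by linarith)

end

end CP3

namespace CP3Hypersurface

noncomputable section

set_option maxSynthPendingDepth 3
set_option linter.unusedSectionVars false

open LocalRiemannian CP3

/-! ## Hypersurfaces in an affine chart -/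

theorem finrank_real_complex_three : Module.finrank ℝ (Fin 3 → ℂ) = 6 := by
  rw [Module.finrank_pi_fintype]
  simp [Complex.finrank_real_complex]

section

variable {E E' : Type*} [NormedAddCommGroup E] [NormedSpace ℝ E] [FiniteDimensional ℝ E]
  [NormedAddCommGroup E'] [NormedSpace ℝ E'] [FiniteDimensional ℝ E']

/-- In codimension one the normal part of v is orthogonal to the tangent space and to N, hence zero;
v is then its own tangential part. -/
theorem exists_fderiv_eq_of_orthogonal {G : E' → E' →L[ℝ] E' →L[ℝ] ℝ} {F : E → E'} {U : Set E}
    {x : E} (hG : IsRiemannianOn G Set.univ) (hF : IsImmersionOn F U) (hx : x ∈ U)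
    (hd : Module.finrank ℝ E' = Module.finrank ℝ E + 1) {N v : E'} (hN : IsUnitNormal G F x N)
    (hv : G (F x) v N = 0) : ∃ X, fderiv ℝ F x X = v := by
  have h : normalPart G F x v = 0 := by
    refine eq_zero_of_normal hG hF hx hd hN (apply_normalPart_fderiv hG hF hx v) ?_
    rw [apply_normalPart_of_normal hN.2, hv]
  exact ⟨_, (sub_eq_zero.1 h).symm⟩

theorem secondFundamentalForm_eq_smul {G : E' → E' →L[ℝ] E' →L[ℝ] ℝ} {F : E → E'} {U : Set E}
    {x : E} (hG : IsRiemannianOn G Set.univ) (hF : IsImmersionOn F U) (hx : x ∈ U)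
    (hd : Module.finrank ℝ E' = Module.finrank ℝ E + 1) {N : E'} (hN : IsUnitNormal G F x N)
    (X Y : E) : secondFundamentalForm G F x X Y =
      G (F x) (secondFundamentalForm G F x X Y) N • N := by
  rw [← sub_eq_zero]
  refine eq_zero_of_normal hG hF hx hd hN (fun W => ?_) ?_
  · rw [map_sub, map_smul, sub_apply, smul_apply, secondFundamentalForm_normal hG hF hx,
      hG.symm _ (Set.mem_univ _) N, hN.2]
    simp
  · simp [hN.1]

end

variable {E : Type*} [NormedAddCommGroup E] [NormedSpace ℝ E] [FiniteDimensional ℝ E]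
  {F : E → Fin 3 → ℂ} {U : Set E} {x : E} {a : ℝ} {i : Fin 4}

/-- The pull-back of the holomorphic contact form by a map in the affine chart `i`. -/
def contactPullback (i : Fin 4) (F : E → Fin 3 → ℂ) (x X : E) : ℂ :=
  symplecticForm (homCoord i (F x)) (homDir i (fderiv ℝ F x X))

theorem hasDerivAt_symplecticForm {z u : ℝ → EuclideanSpace ℂ (Fin 4)}
    {z' u' : EuclideanSpace ℂ (Fin 4)} {t : ℝ} (hz : HasDerivAt z z' t) (hu : HasDerivAt u u' t) :
    HasDerivAt (fun t => symplecticForm (z t) (u t))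
      (symplecticForm z' (u t) + symplecticForm (z t) u') t := by
  have hk : ∀ {y : ℝ → EuclideanSpace ℂ (Fin 4)} {y' : EuclideanSpace ℂ (Fin 4)} (k : Fin 4),
      HasDerivAt y y' t → HasDerivAt (fun t => y t k) (y' k) t := fun k h =>
    ((EuclideanSpace.proj (𝕜 := ℂ) k).restrictScalars ℝ).hasFDerivAt.comp_hasDerivAt t h
  have h := ((((hk 0 hz).mul (hk 1 hu)).sub ((hk 1 hz).mul (hk 0 hu))).add
    ((hk 2 hz).mul (hk 3 hu))).sub ((hk 3 hz).mul (hk 2 hu))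
  refine h.congr_deriv ?_
  simp only [symplecticForm]
  ring

/-- The second-derivative term is symmetric in Y and Z, so antisymmetrising yields dθ, that is,
twice the symplectic form of the two directions. -/
theorem hasDerivAt_contactPullback (i : Fin 4) (hF : IsImmersionOn F U) (hx : x ∈ U) (Y Z : E) :
    HasDerivAt (fun t : ℝ => contactPullback i F (x + t • Z) Y)
      (symplecticForm (homDir i (fderiv ℝ F x Z)) (homDir i (fderiv ℝ F x Y)) +
        symplecticForm (homCoord i (F x)) (homDir i (fderiv ℝ (fderiv ℝ F) x Z Y))) 0 := by
  have h1 : HasDerivAt (fun t : ℝ => homCoord i (F (x + t • Z))) _ 0 :=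
    ((hasFDerivAt_homCoord i (F x)).comp x (hF.hasFDerivAt hx)).hasLineDerivAt Z
  have h2 : HasDerivAt (fun t : ℝ => homDir i (fderiv ℝ F (x + t • Z) Y)) _ 0 :=
    (((homDir i).restrictScalars ℝ).hasFDerivAt.comp x
      (hF.hasFDerivAt_fderiv_apply hx Y)).hasLineDerivAt Z
  have h := hasDerivAt_symplecticForm h1 h2
  simpa [contactPullback] using h

/-- The pull-back of the contact form to a hypersurface with normal vectors in `𝓓₁` is a complex
multiple of a real form, which is impossible as `𝓓₂` is a contact distribution. -/
theorem symplecticForm_im_eq_zero_of_collinear (hF : IsImmersionOn F U) (hx : x ∈ U)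
    (h : ∀ y ∈ U, ∀ X Y,
      (star (contactPullback i F y X) * contactPullback i F y Y).im = 0) (X Y Z : E)
    (hY : contactPullback i F x Y = 0) (hZ : contactPullback i F x Z = 0) :
    (star (contactPullback i F x X) *
      symplecticForm (homDir i (fderiv ℝ F x Y)) (homDir i (fderiv ℝ F x Z))).im = 0 := by
  -- Im(θ̄(X) θ(B)) = 0 is differentiated in direction A; the derivative of θ̄(X) is multiplied by
  -- θ(B) = 0. Subtracting the cases (Y,Z) and (Z,Y) removes the second derivatives of F.
  have key : ∀ A B, contactPullback i F x B = 0 → (star (contactPullback i F x X) *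
      (symplecticForm (homDir i (fderiv ℝ F x A)) (homDir i (fderiv ℝ F x B)) +
        symplecticForm (homCoord i (F x)) (homDir i (fderiv ℝ (fderiv ℝ F) x A B)))).im = 0 := by
    intro A B hB
    have h1 := (hasDerivAt_contactPullback i hF hx X A).star.mul
      (hasDerivAt_contactPullback i hF hx B A)
    have h2 := Complex.imCLM.hasFDerivAt.comp_hasDerivAt 0 h1
    have hline : Filter.Tendsto (fun t : ℝ => x + t • A) (nhds 0) (nhds x) := by
      have : Continuous fun t : ℝ => x + t • A := by fun_prop
      simpa using this.tendsto 0
    have h3 : (fun t : ℝ => (star (contactPullback i F (x + t • A) X) *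
        contactPullback i F (x + t • A) B).im) =ᶠ[nhds 0] fun _ => 0 := by
      filter_upwards [hline (hF.isOpen.mem_nhds hx)] with t ht using h _ ht X B
    have h4 := (h2.congr_of_eventuallyEq h3.symm).unique (hasDerivAt_const (0 : ℝ) (0 : ℝ))
    simpa [hB] using h4
  have h1 := key Y Z hZ
  have h2 := key Z Y hY
  rw [hF.fderiv_fderiv_comm hx Z Y,
    symplecticForm_swap (homDir i (fderiv ℝ F x Z)) (homDir i (fderiv ℝ F x Y))] at h2
  simp only [mul_add, mul_neg, Complex.add_im, Complex.neg_im] at h1 h2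
  linarith

/-- If `R(X, Y, Z, N) = 0` for tangent vectors with `Z` orthogonal to `X` and `Y`, then the normal
vector `N` lies in `𝓓₁`. -/
theorem contactPullback_of_curvature_normal (ha : 0 < a) (hF : IsImmersionOn F U) (hx : x ∈ U)
    (hd : Module.finrank ℝ E = 5)
    (hR : ∀ N, IsUnitNormal (metric a i) F x N → ∀ X Y Z,
      pullbackMetric (metric a i) F x X Z = 0 → pullbackMetric (metric a i) F x Y Z = 0 →
      metric a i (F x) (curvature (metric a i) (F x) (fderiv ℝ F x X) (fderiv ℝ F x Y)
        (fderiv ℝ F x Z)) N = 0) :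
    (∀ X Y, (star (contactPullback i F x X) * contactPullback i F x Y).im = 0) ∧
      ∃ X Y Z, contactPullback i F x Y = 0 ∧ contactPullback i F x Z = 0 ∧
        (star (contactPullback i F x X) *
          symplecticForm (homDir i (fderiv ℝ F x Y)) (homDir i (fderiv ℝ F x Z))).im ≠ 0 := by
  have hG := isRiemannianOn_metric a ha i
  have hd' : Module.finrank ℝ (Fin 3 → ℂ) = Module.finrank ℝ E + 1 := by
    rw [finrank_real_complex_three, hd]
  obtain ⟨N, hN⟩ := exists_isUnitNormal hG (by omega) F x
  obtain ⟨φ, V, c, r, s, hφ, h0, hφ0, hiso, hNφ, hc, hS, hSS⟩ := exists_adapted_isometry a i (F x) N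
  have hm : ∀ u v, metric a i (F x) (fderiv ℝ φ 0 u) (fderiv ℝ φ 0 v) = metric a 0 0 u v := by
    intro u v
    rw [← hiso 0 h0, pullbackMetric_apply, hφ0]
  have ht : ∀ u, metric a 0 0 u ![(r : ℂ), (s : ℂ), 0] = 0 →
      ∃ X, fderiv ℝ F x X = fderiv ℝ φ 0 u := by
    intro u hu
    refine exists_fderiv_eq_of_orthogonal hG hF hx hd' hN ?_
    rw [← hNφ, hm, hu]
  have hs : s = 0 := by
    obtain ⟨X, hX⟩ := ht ![0, Complex.I, 0] (by simp [metric_zero_zero, herm])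
    obtain ⟨Y, hY⟩ := ht ![0, 0, 1] (by simp [metric_zero_zero, herm])
    obtain ⟨Z, hZ⟩ := ht ![0, 0, Complex.I] (by simp [metric_zero_zero, herm])
    have h1 := hR N hN X Y Z
      (by rw [pullbackMetric_apply, hX, hZ, hm]; simp [metric_zero_zero, herm])
      (by rw [pullbackMetric_apply, hY, hZ, hm]; simp [metric_zero_zero, herm])
    have h2 := curvature_of_isometry hG hφ h0 hiso ![0, Complex.I, 0] ![0, 0, 1] ![0, 0, Complex.I]
      ![(r : ℂ), (s : ℂ), 0]
    rw [apply_curvature_metric_zero a ha, centralCurvature_normal, hφ0, hNφ, ← hX, ← hY, ← hZ,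
      h1] at h2
    linarith
  subst hs
  have hr : r ≠ 0 := by
    rintro rfl
    have h1 := hN.1
    have h2 : (![((0 : ℝ) : ℂ), ((0 : ℝ) : ℂ), 0] : Fin 3 → ℂ) = 0 := by
      funext k
      fin_cases k <;> simp
    rw [← hNφ, h2] at h1
    simp at h1
  have hsurj : Function.Surjective (fderiv ℝ φ 0) :=
    LinearMap.injective_iff_surjective.1 (hφ.injective 0 h0)
  -- With normal (r, 0, 0), tangent vectors are those with Re(u 0) = 0, so θ takes values on the
  -- real line c² iℝ.
  have hre : ∀ X, ∃ p : ℝ, contactPullback i F x X = c ^ 2 * (p * Complex.I) := by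
    intro X
    obtain ⟨u, hu⟩ := hsurj (fderiv ℝ F x X)
    have h1 := hN.2 X
    rw [← hu, ← hNφ, hm, metric_zero_zero] at h1
    simp [herm] at h1
    have h2 : (u 0).re = 0 := by
      have : r * (u 0).re = 0 := by linarith
      exact (mul_eq_zero.1 this).resolve_left hr
    refine ⟨(u 0).im, ?_⟩
    rw [contactPullback, ← hu, hS]
    congr 1
    apply Complex.ext <;> simp [h2]
  have hcc : ∀ y : ℂ, star (c ^ 2 * y) * (c ^ 2) = ((‖c‖ ^ 4 : ℝ) : ℂ) * star y := by
    intro y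
    have := Complex.conj_mul' c
    simp only [Complex.star_def, map_mul, map_pow]
    push_cast
    linear_combination (starRingEnd ℂ y) * ((starRingEnd ℂ c) * c + (‖c‖ : ℂ) ^ 2) * this
  refine ⟨fun X Y => ?_, ?_⟩
  · obtain ⟨p, hp⟩ := hre X
    obtain ⟨q, hq⟩ := hre Y
    rw [hp, hq, ← mul_assoc, hcc, mul_assoc, Complex.im_ofReal_mul]
    simp
  -- Here θ(X) = c² i, while Y and Z span a plane of 𝓓₂ with σ(Y,Z) = c², off the line c² iℝ.
  · obtain ⟨X, hX⟩ := ht ![Complex.I, 0, 0] (by simp [metric_zero_zero, herm])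
    obtain ⟨Y, hY⟩ := ht ![0, 1, 0] (by simp [metric_zero_zero, herm])
    obtain ⟨Z, hZ⟩ := ht ![0, 0, 1] (by simp [metric_zero_zero, herm])
    refine ⟨X, Y, Z, ?_, ?_, ?_⟩
    · rw [contactPullback, hY, hS]
      simp
    · rw [contactPullback, hZ, hS]
      simp
    · rw [contactPullback, hX, hY, hZ, hS, hSS _ _ (by simp) (by simp)]
      have : (![0, 1, 0] : Fin 3 → ℂ) 1 * (![0, 0, 1] : Fin 3 → ℂ) 2
          - (![0, 1, 0] : Fin 3 → ℂ) 2 * (![0, 0, 1] : Fin 3 → ℂ) 1 = 1 := by simp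
      rw [this, mul_one, hcc, Complex.im_ofReal_mul]
      simp [hc]

/-- The curvature condition is required on an open set because the collinearity of the contact
values has to be differentiated. -/
theorem not_curvature_normal (ha : 0 < a) (hF : IsImmersionOn F U) (hU : U.Nonempty)
    (hd : Module.finrank ℝ E = 5)
    (hR : ∀ x ∈ U, ∀ N, IsUnitNormal (metric a i) F x N → ∀ X Y Z,
      pullbackMetric (metric a i) F x X Z = 0 → pullbackMetric (metric a i) F x Y Z = 0 →
      metric a i (F x) (curvature (metric a i) (F x) (fderiv ℝ F x X) (fderiv ℝ F x Y)
        (fderiv ℝ F x Z)) N = 0) : False := by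
  obtain ⟨x, hx⟩ := hU
  obtain ⟨-, X, Y, Z, hY, hZ, h⟩ := contactPullback_of_curvature_normal ha hF hx hd (hR x hx)
  exact h (symplecticForm_im_eq_zero_of_collinear hF hx
    (fun y hy => (contactPullback_of_curvature_normal ha hF hy hd (hR y hy)).1) X Y Z hY hZ)

/-- The obstruction is pointwise: writing h as a real form times N, the Gauss equation at one point
is transported to the centre by the adapted isometry. -/
theorem not_hasSectionalCurvatureAt (ha : 0 < a) (hF : IsImmersionOn F U) (hx : x ∈ U)
    (hd : Module.finrank ℝ E = 5) (c : ℝ) : ¬ HasSectionalCurvatureAt (metric a i) F c x := by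
  intro hK
  have hG := isRiemannianOn_metric a ha i
  have hd' : Module.finrank ℝ (Fin 3 → ℂ) = Module.finrank ℝ E + 1 := by
    rw [finrank_real_complex_three, hd]
  obtain ⟨N, hN⟩ := exists_isUnitNormal hG (by omega) F x
  obtain ⟨φ, V, k, r, s, hφ, h0, hφ0, hiso, hNφ, -, -, -⟩ := exists_adapted_isometry a i (F x) N
  have hm : ∀ u v, metric a i (F x) (fderiv ℝ φ 0 u) (fderiv ℝ φ 0 v) = metric a 0 0 u v := by
    intro u v
    rw [← hiso 0 h0, pullbackMetric_apply, hφ0]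
  -- Preimages are chosen for all u, with value 0 off the hyperplane, since the algebraic lemma
  -- takes a form h defined on the whole central tangent space.
  have ht : ∀ u, ∃ X, metric a 0 0 u ![(r : ℂ), (s : ℂ), 0] = 0 →
      fderiv ℝ F x X = fderiv ℝ φ 0 u := by
    intro u
    by_cases hu : metric a 0 0 u ![(r : ℂ), (s : ℂ), 0] = 0
    · obtain ⟨X, hX⟩ := exists_fderiv_eq_of_orthogonal hG hF hx hd' hN
        (v := fderiv ℝ φ 0 u) (by rw [← hNφ, hm, hu])
      exact ⟨X, fun _ => hX⟩
    · exact ⟨0, fun h => absurd h hu⟩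
  choose t ht using ht
  have hII : ∀ A B C D, metric a i (F x) (secondFundamentalForm (metric a i) F x A B)
      (secondFundamentalForm (metric a i) F x C D) =
      metric a i (F x) (secondFundamentalForm (metric a i) F x A B) N *
      metric a i (F x) (secondFundamentalForm (metric a i) F x C D) N := by
    intro A B C D
    conv_lhs => rw [secondFundamentalForm_eq_smul hG hF hx hd' hN C D]
    rw [map_smul, smul_eq_mul, mul_comm]
  refine not_gauss_constant_curvature ha r s c ?_
    (fun X Y => metric a i (F x) (secondFundamentalForm (metric a i) F x (t X) (t Y)) N) ?_ ?_
  · by_contra! hrs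
    obtain ⟨rfl, rfl⟩ := hrs
    have h1 := hN.1
    have h2 : (![((0 : ℝ) : ℂ), ((0 : ℝ) : ℂ), 0] : Fin 3 → ℂ) = 0 := by
      funext k
      fin_cases k <;> simp
    rw [← hNφ, h2] at h1
    simp at h1
  · intro X Y _ _
    rw [secondFundamentalForm_comm hG hF hx]
  · intro X Y Z W hX hY hZ hW
    rw [← apply_curvature_metric_zero a ha, ← curvature_of_isometry hG hφ h0 hiso, hφ0,
      ← ht X hX, ← ht Y hY, ← ht Z hZ, ← ht W hW, gauss_equation hG hF hx, hK, hII, hII]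
    simp only [map_smul, map_sub, smul_apply, sub_apply, smul_eq_mul, pullbackMetric_apply,
      ht X hX, ht Y hY, ht Z hZ, ht W hW, hm]

end

end CP3Hypersurface

/-! ### From manifolds to coordinate expressions -/

namespace CP3Hypersurface

noncomputable section

set_option maxSynthPendingDepth 3

open LocalRiemannian CP3

/-- A hypersurface has a coordinate expression which is an immersion on a nonempty open set. -/
theorem IsImmersedHypersurface.exists_isImmersionOn {M : Type*} [TopologicalSpace M]
    [ChartedSpace (EuclideanSpace ℝ (Fin 5)) M]
    [IsManifold 𝓘(ℝ, EuclideanSpace ℝ (Fin 5)) ∞ M] [Nonempty M] {f : M → CP3}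
    (hf : IsImmersedHypersurface f) :
    ∃ e ∈ IsManifold.maximalAtlas 𝓘(ℝ, EuclideanSpace ℝ (Fin 5)) ∞ M, ∃ i : Fin 4,
      ∃ U : Set (EuclideanSpace ℝ (Fin 5)), U.Nonempty ∧
        (∀ x ∈ U, x ∈ e.target ∧ f (e.symm x) ∈ (affineChart i).source) ∧
        IsImmersionOn (affineChart i ∘ f ∘ e.symm) U := by
  obtain ⟨m⟩ := ‹Nonempty M›
  set e := chartAt (EuclideanSpace ℝ (Fin 5)) m with he
  obtain ⟨i, hi⟩ := exists_mem_affineChart (f m)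
  have hec : e ∈ atlas (EuclideanSpace ℝ (Fin 5)) M := chart_mem_atlas _ m
  have hem : e ∈ IsManifold.maximalAtlas 𝓘(ℝ, EuclideanSpace ℝ (Fin 5)) ∞ M :=
    IsManifold.chart_mem_maximalAtlas m
  have hia : affineChart i ∈ atlas (Fin 3 → ℂ) CP3 := ⟨i, rfl⟩
  have him : affineChart i ∈ IsManifold.maximalAtlas 𝓘(ℝ, Fin 3 → ℂ) ∞ CP3 :=
    IsManifold.subset_maximalAtlas hia
  have hU : IsOpen (e.target ∩ e.symm ⁻¹' (f ⁻¹' (affineChart i).source)) :=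
    e.symm.isOpen_inter_preimage ((affineChart i).open_source.preimage hf.1.continuous)
  have hde : e.MDifferentiable 𝓘(ℝ, EuclideanSpace ℝ (Fin 5)) 𝓘(ℝ, EuclideanSpace ℝ (Fin 5)) :=
    mdifferentiable_of_mem_atlas hec
  have hdi : (affineChart i).MDifferentiable 𝓘(ℝ, Fin 3 → ℂ) 𝓘(ℝ, Fin 3 → ℂ) :=
    mdifferentiable_of_mem_atlas hia
  refine ⟨e, hem, i, e.target ∩ e.symm ⁻¹' (f ⁻¹' (affineChart i).source),
    ⟨e m, e.map_source (mem_chart_source _ m), ?_⟩, fun x hx => hx, hU, ?_, ?_⟩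
  · rw [Set.mem_preimage, Set.mem_preimage, e.left_inv (mem_chart_source _ m)]
    exact hi
  · rw [← contMDiffOn_iff_contDiffOn]
    refine (contMDiffOn_of_mem_maximalAtlas him).comp (hf.1.comp_contMDiffOn
      ((contMDiffOn_symm_of_mem_maximalAtlas hem).mono Set.inter_subset_left)) ?_
    exact fun x hx => hx.2
  · rintro x ⟨hx, hx'⟩
    have h1 := hde.symm.mdifferentiableAt (x := x) hx
    have h2 : MDifferentiableAt 𝓘(ℝ, EuclideanSpace ℝ (Fin 5)) 𝓘(ℝ, Fin 3 → ℂ) f (e.symm x) :=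
      hf.1.mdifferentiableAt (by simp)
    have h3 := hdi.mdifferentiableAt hx'
    rw [← mfderiv_eq_fderiv, mfderiv_comp x h3 (h2.comp x h1), mfderiv_comp x h2 h1]
    exact (hdi.mfderiv_injective hx').comp ((hf.2 _).comp (hde.symm.mfderiv_injective hx))

end

end CP3Hypersurface

theorem theoremC (a : ℝ) (ha : 0 < a)
    {M : Type*} [TopologicalSpace M] [ChartedSpace (EuclideanSpace ℝ (Fin 5)) M]
    [IsManifold 𝓘(ℝ, EuclideanSpace ℝ (Fin 5)) ∞ M] [Nonempty M]
    (f : M → CP3) (hf : CP3Hypersurface.IsImmersedHypersurface f) :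
    ¬ CP3Hypersurface.IsCodazzi a f ∧
    ¬ CP3Hypersurface.IsParallel a f ∧
    ¬ CP3Hypersurface.IsTotallyGeodesic a f ∧
    ¬ CP3Hypersurface.IsTotallyUmbilical a f ∧
    ¬ CP3Hypersurface.HasConstantSectionalCurvature a f := by
  obtain ⟨e, he, i, U, hne, hU, hF⟩ := hf.exists_isImmersionOn
  have hG := CP3.isRiemannianOn_metric a ha i
  have hd : Module.finrank ℝ (EuclideanSpace ℝ (Fin 5)) = 5 := by simp
  have hd' : Module.finrank ℝ (Fin 3 → ℂ) = Module.finrank ℝ (EuclideanSpace ℝ (Fin 5)) + 1 := by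
    rw [CP3Hypersurface.finrank_real_complex_three, hd]
  have hC : ¬ CP3Hypersurface.IsCodazzi a f := fun h =>
    CP3Hypersurface.not_curvature_normal ha hF hne hd fun x hx N hN X Y Z _ _ =>
      LocalRiemannian.apply_curvature_normal_of_codazzi hG hF hx
        (h e he i x (hU x hx).1 (hU x hx).2) hN.2 X Y Z
  have hUmb : ¬ CP3Hypersurface.IsTotallyUmbilical a f := fun h =>
    CP3Hypersurface.not_curvature_normal ha hF hne hd fun x hx N hN X Y Z hXZ hYZ =>
      LocalRiemannian.apply_curvature_normal_of_umbilical hG hF hx hd'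
        (fun y hy => h e he i y (hU y hy).1 (hU y hy).2) hN.2 hXZ hYZ
  -- Parallel implies Codazzi-like; totally geodesic is treated as umbilical with factor 0, which
  -- avoids differentiating h = 0.
  refine ⟨hC, fun h => hC fun e' he' j x hx hx' X Y Z => ?_,
    fun h => hUmb fun e' he' j x hx hx' N _ => ⟨0, fun X Y => ?_⟩, hUmb, ?_⟩
  · have h' := h e' he' j x hx hx'
    exact ⟨(h' X Y Z).trans (h' Y X Z).symm, (h' X Y Z).trans (h' X Z Y).symm⟩
  · rw [h e' he' j x hx hx' X Y]
    simp
  · rintro ⟨c, h⟩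
    obtain ⟨x, hx⟩ := hne
    exact CP3Hypersurface.not_hasSectionalCurvatureAt ha hF hx hd c
      (h e he i x (hU x hx).1 (hU x hx).2)
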